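/- \textbf{Theorem.} Let $U(R)$ be the unital associative complex algebra generated by $L_m, G_m$ ($m\in\mathbb Z$), a central element $C$ and the parity operator $(-1)^F$, subject to $[L_m,L_n]=(m-n)L_{m+n}+\frac{C}{12}(m^3-m)\delta_{m+n,0}$, $[L_m,G_n]=(\frac m2-n)G_{m+n}$, $\{G_m,G_n\}=2L_{m+n}+\frac C3(m^2-\frac14)\delta_{m+n,0}$, with $(-1)^F$ commuting with all $L_m$ and anticommuting with all $G_m$ (the enveloping algebra of the extended $N=1$ Ramond algebra). For $c,\Delta\in\mathbb C$ let $\mathcal V_\Delta$ be the Verma module generated freely by a vector $|\Delta\rangle$ with $L_0|\Delta\rangle=\Delta|\Delta\rangle$, $C|\Delta\rangle=c|\Delta\rangle$, $(-1)^F|\Delta\rangle=|\Delta\rangle$ and $L_m|\Delta\rangle=G_m|\Delta\rangle=0$ for $m\ge1$; let $\mathcal V^G_{c/24}$ be the $G$-closed Verma module, defined in the same way with $\Delta=\frac c{24}$ and the additional condition $G_0|\tfrac c{24}\rangle=0$. A singular vector of level $l\in\mathbb N_0$ and parity $p\in\{+,-\}$ in a module of highest weight $\Delta$ is a vector $v$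 with $L_0v=(\Delta+l)v$, $(-1)^Fv=pv$ and $L_mv=G_mv=0$ for all $m\ge 1$ that is not a multiple (including $0$) of the highest weight vector; it is $G$-closed if moreover $G_0v=0$. For each parity $p\in\{+,-\}$: \begin{enumerate} \item for all $c,\Delta,l$ the singular vectors of level $l$ and parity $p$ in $\mathcal V_\Delta$ span a space of dimension at most $2$, and dimension $2$ is attained for some $c,\Delta,l$; \item for all $c,l$ the singular vectors of level $l$ and parity $p$ in $\mathcal V^G_{c/24}$ span a space of dimension at most $1$, and dimension $1$ is attained for some $c,l$; \item for all $c,\Delta,l$ the $G$-closed singular vectors of level $l$ and parity $p$ in $\mathcal V_\Delta$ span a space of dimension at most $1$, and dimension $1$ is attained for some $c,\Delta,l$; \item for all $c,l$ the module $\mathcal V^G_{c/24}$ contains no $G$-closed singular vector of level $l$ and parity $p$. \end{enumerate} -/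

import Mathlib

namespace Ramond

/-- Generators of the (extended) `N = 1` Ramond algebra: the Virasoro modes `L_m` and the
fermionic modes `G_m` (`m ∈ ℤ`), the central element `C` and the parity operator `(-1)^F`. -/
inductive Gen : Type
  | L (m : ℤ)
  | G (m : ℤ)
  | C
  | F

/-- A generator as an element of the free associative algebra. -/
abbrev gen (x : Gen) : FreeAlgebra ℂ Gen := FreeAlgebra.ι ℂ x

/-- The (anti)commutation relations of the Ramond algebra, read in an associative algebra.
(The relation `((-1)^F)^2 = 1` is not imposed on the algebra; it holds automatically in every
module generated by an eigenvector of `(-1)^F` with eigenvalue `1`.) -/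
inductive Rel : FreeAlgebra ℂ Gen → FreeAlgebra ℂ Gen → Prop
  | LL (m n : ℤ) : Rel (gen (.L m) * gen (.L n) - gen (.L n) * gen (.L m))
      (((m : ℂ) - (n : ℂ)) • gen (.L (m + n)) +
        (if m + n = 0 then ((m : ℂ) ^ 3 - (m : ℂ)) / 12 else 0) • gen .C)
  | LG (m n : ℤ) : Rel (gen (.L m) * gen (.G n) - gen (.G n) * gen (.L m))
      (((m : ℂ) / 2 - (n : ℂ)) • gen (.G (m + n)))
  | GG (m n : ℤ) : Rel (gen (.G m) * gen (.G n) + gen (.G n) * gen (.G m))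
      ((2 : ℂ) • gen (.L (m + n)) +
        (if m + n = 0 then ((m : ℂ) ^ 2 - 1 / 4) / 3 else 0) • gen .C)
  | LC (m : ℤ) : Rel (gen (.L m) * gen .C) (gen .C * gen (.L m))
  | GC (m : ℤ) : Rel (gen (.G m) * gen .C) (gen .C * gen (.G m))
  | FL (m : ℤ) : Rel (gen .F * gen (.L m)) (gen (.L m) * gen .F)
  | FC : Rel (gen .F * gen .C) (gen .C * gen .F)
  | FG (m : ℤ) : Rel (gen .F * gen (.G m) + gen (.G m) * gen .F) 0

/-- The universal enveloping algebra `U(R)` of the (extended) Ramond algebra: the associative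
unital complex algebra with the above generators and relations. -/
abbrev U : Type := RingQuot Rel

/-- The image of a generator in `U(R)`. -/
noncomputable def op (x : Gen) : U := RingQuot.mkAlgHom ℂ Rel (gen x)

/-- The mode `L_m` in `U(R)`. -/
noncomputable abbrev L (m : ℤ) : U := op (.L m)

/-- The mode `G_m` in `U(R)`. -/
noncomputable abbrev G (m : ℤ) : U := op (.G m)

/-- The central element in `U(R)`. -/
noncomputable abbrev C : U := op .C

/-- The parity operator `(-1)^F` in `U(R)`. -/
noncomputable abbrev F : U := op .F

/-- The conditions on a highest weight vector of conformal weight `Δ`, central charge `c` and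
positive parity, as elements of `U(R)` that annihilate it. -/
def highestWeightConditions (c Δ : ℂ) : Set U :=
  {x | ∃ m : ℤ, 0 < m ∧ (x = L m ∨ x = G m)} ∪
    {L 0 - algebraMap ℂ U Δ, C - algebraMap ℂ U c, F - 1}

/-- The Verma module of weight `Δ` and central charge `c`, i.e. the left `U(R)`-module induced
from the one-dimensional module on which `L_0, C, (-1)^F` act by `Δ, c, 1` and the positive modes
by `0`, written as the quotient of `U(R)` by the left ideal that these conditions generate. -/
abbrev Verma (c Δ : ℂ) : Type := U ⧸ Submodule.span U (highestWeightConditions c Δ)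

/-- The `G`-closed Verma module of central charge `c`: the module induced from a highest weight
vector of weight `c / 24` that is in addition annihilated by `G_0`. -/
abbrev GVerma (c : ℂ) : Type :=
  U ⧸ Submodule.span U (highestWeightConditions c (c / 24) ∪ {G 0})

/-- The highest weight vector of the Verma module. -/
noncomputable def Verma.hw (c Δ : ℂ) : Verma c Δ := Submodule.Quotient.mk 1

/-- The highest weight vector of the `G`-closed Verma module. -/
noncomputable def GVerma.hw (c : ℂ) : GVerma c := Submodule.Quotient.mk 1

section Singular

variable {M : Type} [AddCommGroup M] [Module ℂ M] [Module U M]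

/-- `v` is a singular vector of level `l` and parity `p` in a module with highest weight vector
`w` of conformal weight `Δ`: an eigenvector of `L_0` and `(-1)^F` with eigenvalues `Δ + l` and `p`
that is annihilated by all positive modes and is not a multiple of `w` (in particular `v ≠ 0`).
The central element acts as a scalar on the modules in question. -/
structure IsSingular (Δ : ℂ) (w : M) (l : ℕ) (p : ℤˣ) (v : M) : Prop where
  weight : L 0 • v = (Δ + (l : ℂ)) • v
  parity : F • v = (((p : ℤ) : ℂ)) • v
  annihilated_L : ∀ m : ℤ, 0 < m → L m • v = 0
  annihilated_G : ∀ m : ℤ, 0 < m → G m • v = 0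
  not_proportional : ∀ a : ℂ, v ≠ a • w

/-- A `G`-closed singular vector: a singular vector annihilated by `G_0`. -/
structure IsGClosedSingular (Δ : ℂ) (w : M) (l : ℕ) (p : ℤˣ) (v : M) : Prop
    extends IsSingular Δ w l p v where
  gclosed : G 0 • v = 0

end Singular

/-- The space spanned by the singular vectors of level `l` and parity `p` in the Verma module. -/
noncomputable def singularSpace (c Δ : ℂ) (l : ℕ) (p : ℤˣ) : Submodule ℂ (Verma c Δ) :=
  Submodule.span ℂ {v | IsSingular Δ (Verma.hw c Δ) l p v}

/-- The space spanned by the `G`-closed singular vectors of level `l` and parity `p` in the Verma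
module. -/
noncomputable def gClosedSingularSpace (c Δ : ℂ) (l : ℕ) (p : ℤˣ) : Submodule ℂ (Verma c Δ) :=
  Submodule.span ℂ {v | IsGClosedSingular Δ (Verma.hw c Δ) l p v}

/-- The space spanned by the singular vectors of level `l` and parity `p` in the `G`-closed Verma
module. -/
noncomputable def gVermaSingularSpace (c : ℂ) (l : ℕ) (p : ℤˣ) : Submodule ℂ (GVerma c) :=
  Submodule.span ℂ {v | IsSingular (c / 24) (GVerma.hw c) l p v}

end Ramond

/-! Everything rests on a Poincaré–Birkhoff–Witt basis of sorted words in the lowering modes. To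
obtain it, the span of the words is made into a module: `act` straightens a mode applied to a word,
and `defect_eq_zero` verifies the relations by induction on the length of the word, the heart being
the super Jacobi identity. By `injective_of_map_eq_vac`, the homomorphisms from the two induced
modules that send highest weight vector to empty word are injective. Both modules are treated at
once; they differ only in whether `G_0` counts as a lowering mode (threshold 1) or kills the highest
weight vector (threshold 0).

Upper bounds: give `L_{-1}` weight 3 and every other lowering mode weight 2. Let `M` be a word of
maximal weight in a nonzero vector `v` killed by the positive modes. If `M` had a letter `y` with
mode number at most `-2`, then the mode `x` with index `(0, -1) - y` is positive and `[x, y]` is a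
nonzero multiple of `L_{-1}`. Replacing one `y` in `M` by `L_{-1}` raises the weight by one, and no
other word of `v` contributes to the result, so `x v ≠ 0`, a contradiction
(`neg_one_le_of_leading`). Hence `M = G_{-1}^a L_{-1}^b G_0^d` with `a, d ≤ 1`, and for given level
and parity `M` is determined by `d`. A singular vector is thus determined by two coefficients, and
the dimension is at most 2. In the `G`-closed Verma module `d = 0`. For a `G`-closed vector of the
Verma module `d = 1`, since otherwise inserting `G_0` into `M` gives a nonzero term of `G_0 v`
(`G_zero_mem_of_leading`). So both dimensions are at most 1. Finally `G_0^2 = L_0 - c/24` forces a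
`G`-closed vector of the `G`-closed Verma module into level 0, where only multiples of the highest
weight vector live.

Sharpness: explicit vectors, the main one a pair at level 3 for `c = 0`, `Δ = 1`. Where `G_0^2` acts
by a nonzero scalar, `G_0` carries examples to the opposite parity. -/

namespace Ramond

/-! ### The superbracket in uniform notation and its Jacobi identity. -/

/-- The pairs of a parity and a mode number, which index the modes `L_m` and `G_m`. -/
abbrev Mode : Type := ZMod 2 × ℤ

/-- The sign `(-1)^{|x||y|}` of the exchange of two homogeneous elements. -/
noncomputable def sgn (x y : Mode) : ℂ := if x.1 = 0 then 1 else if y.1 = 0 then 1 else -1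

/-- The structure constant of the superbracket of two modes. -/
noncomputable def str (x y : Mode) : ℂ :=
  if x.1 = 0 then (if y.1 = 0 then (x.2 : ℂ) - y.2 else (x.2 : ℂ) / 2 - y.2)
  else if y.1 = 0 then (x.2 : ℂ) - (y.2 : ℂ) / 2 else 2

/-- The coefficient of the central element in the superbracket of two modes. -/
noncomputable def cen (x y : Mode) : ℂ :=
  if x + y = 0 then
    (if x.1 = 0 then ((x.2 : ℂ) ^ 3 - x.2) / 12 else ((x.2 : ℂ) ^ 2 - 1 / 4) / 3)
  else 0

lemma parity_cases (a : ZMod 2) : a = 0 ∨ a = 1 := by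
  revert a; decide

lemma one_add_one_parity : (1 : ZMod 2) + 1 = 0 := by decide

lemma sgn_eq_or (x y : Mode) : sgn x y = 1 ∨ sgn x y = -1 := by
  unfold sgn; split_ifs <;> simp

lemma sgn_comm (x y : Mode) : sgn y x = sgn x y := by
  unfold sgn; split_ifs <;> rfl

lemma sgn_add_right (x y t : Mode) : sgn x (y + t) = sgn x y * sgn x t := by
  obtain ⟨a, m⟩ := x; obtain ⟨b, n⟩ := y; obtain ⟨d, k⟩ := t
  rcases parity_cases a with rfl | rfl <;> rcases parity_cases b with rfl | rfl <;>
    rcases parity_cases d with rfl | rfl <;> simp [sgn, one_add_one_parity]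

lemma sgn_add_left (x y t : Mode) : sgn (x + y) t = sgn x t * sgn y t := by
  rw [sgn_comm, sgn_add_right, sgn_comm x, sgn_comm y]

lemma str_comm (x y : Mode) : str y x = -sgn x y * str x y := by
  obtain ⟨a, m⟩ := x; obtain ⟨b, n⟩ := y
  rcases parity_cases a with rfl | rfl <;> rcases parity_cases b with rfl | rfl <;>
    simp [sgn, str]

lemma cen_comm (x y : Mode) : cen y x = -sgn x y * cen x y := by
  obtain ⟨a, m⟩ := x; obtain ⟨b, n⟩ := y
  by_cases h : m + n = 0
  · obtain rfl : n = -m := by omega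
    rcases parity_cases a with rfl | rfl <;> rcases parity_cases b with rfl | rfl <;>
      simp [sgn, cen, one_add_one_parity]
    ring
  · simp [cen, h, add_comm n m]

/-- This and `cen_jacobi` are the noncentral and the central coefficient of `[x,[y,t]] = [[x,y],t] ±
[y,[x,t]]`. -/
lemma str_jacobi (x y t : Mode) :
    str y t * str x (y + t) = str x y * str (x + y) t + sgn x y * (str x t * str y (x + t)) := by
  obtain ⟨a, m⟩ := x; obtain ⟨b, n⟩ := y; obtain ⟨d, k⟩ := t
  rcases parity_cases a with rfl | rfl <;> rcases parity_cases b with rfl | rfl <;>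
    rcases parity_cases d with rfl | rfl <;>
    simp [sgn, str, one_add_one_parity] <;> ring

lemma cen_jacobi (x y t : Mode) :
    str y t * cen x (y + t) = str x y * cen (x + y) t + sgn x y * (str x t * cen y (x + t)) := by
  obtain ⟨a, m⟩ := x; obtain ⟨b, n⟩ := y; obtain ⟨d, k⟩ := t
  by_cases h : m + n + k = 0
  · obtain rfl : k = -m - n := by omega
    have h3 : n + (m + (-m - n)) = 0 := by ring
    rcases parity_cases a with rfl | rfl <;> rcases parity_cases b with rfl | rfl <;>
      rcases parity_cases d with rfl | rfl <;>
      simp [sgn, str, cen, one_add_one_parity, h3] <;> ring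
  · have h1 : ¬ (m + (n + k) = 0) := by omega
    have h2 : ¬ (n + (m + k) = 0) := by omega
    simp [cen, h, h1, h2]

/-- The sorting key: the modes are ordered as `…, G_{-1}, L_{-1}, G_0, L_0, G_1, L_1, …`. -/
def key (x : Mode) : ℤ := 2 * x.2 + (if x.1 = 0 then 1 else 0)

lemma key_injective : Function.Injective key := by
  rintro ⟨a, m⟩ ⟨b, n⟩ h
  rcases parity_cases a with rfl | rfl <;> rcases parity_cases b with rfl | rfl <;>
    simp [key] at h ⊢ <;> omega

lemma str_self_of_even {x : Mode} (h : x.1 = 0) : str x x = 0 := by simp [str, h]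

lemma sgn_of_even {x y : Mode} (h : x.1 = 0) : sgn x y = 1 := by simp [sgn, h]

lemma sgn_self_of_odd {x : Mode} (h : x.1 ≠ 0) : sgn x x = -1 := by simp [sgn, h]

lemma cen_self_of_even {x : Mode} (h : x.1 = 0) : cen x x = 0 := by
  obtain ⟨a, m⟩ := x
  simp only at h
  subst h
  by_cases hm : m = 0 <;> simp [cen, hm]

/-- With `cen_self_add_self_of_odd` this says `[x,[x,x]] = 0`, needed when three equal odd modes
meet. -/
lemma str_self_add_self_of_odd {x : Mode} (h : x.1 ≠ 0) : str x (x + x) = 0 := by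
  obtain ⟨a, m⟩ := x
  obtain rfl : a = 1 := (parity_cases a).resolve_left h
  simp [str, one_add_one_parity]

lemma cen_self_add_self_of_odd {x : Mode} (h : x.1 ≠ 0) : cen x (x + x) = 0 := by
  obtain ⟨a, m⟩ := x
  obtain rfl : a = 1 := (parity_cases a).resolve_left h
  simp [cen, one_add_one_parity]

/-- A central term needs `x + y = 0`, so `x` and `y` have the same parity. This matches the signs of
the terms in which a central pair leaves the third mode behind. -/
lemma cen_mul_sgn (x y t : Mode) : cen x y * sgn x t = cen x y * sgn y t := by
  by_cases h : x + y = 0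
  · have h1 : x.1 + y.1 = 0 := congrArg Prod.fst h
    have h2 : x.1 = 0 ↔ y.1 = 0 := by
      revert h1; generalize x.1 = a; generalize y.1 = b; revert a b; decide
    simp only [sgn, h2]
  · simp [cen, h]

lemma cen_of_add_ne {x y : Mode} (h : x + y ≠ 0) : cen x y = 0 := by simp [cen, h]

end Ramond

/-! ### The Poincaré–Birkhoff–Witt space: straightening of words and the relations of the modes. -/

namespace Ramond

/-- The data of a highest weight module: the central charge, the conformal weight and the
threshold of the sorting key from which on a mode acts on the highest weight vector by a scalar
(`1` for the Verma module, `0` for the `G`-closed one). -/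
structure HWData where
  charge : ℂ
  confWeight : ℂ
  threshold : ℤ
  -- Since `G_0^2 = L_0 - C/24`, the mode `G_0` can kill the highest weight vector only at weight
  -- `c/24`.
  consistent : threshold = 1 ∨ threshold = 0 ∧ confWeight = charge / 24

namespace HWData

variable (D : HWData)

/-- The filtration weight of a mode. -/
def weight (x : Mode) : ℕ :=
  if x = (0, -1) then 3 else if key x < D.threshold then 2 else 1

/-- The filtration weight of a word. -/
def wt (m : List Mode) : ℕ := (m.map D.weight).sum

/-- The scalar by which a mode above the threshold acts on the highest weight vector. -/
noncomputable def chi (x : Mode) : ℂ := if x = 0 then D.confWeight else 0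

/-- The mode `x` may be put in front of the sorted word `m`. -/
def Ok (x : Mode) (m : List Mode) : Prop :=
  key x < D.threshold ∧ ∀ y ∈ m, key x < key y ∨ (x = y ∧ x.1 = 0)

/-- The sorted words, which index the Poincaré–Birkhoff–Witt basis. -/
def Good : List Mode → Prop
  | [] => True
  | x :: m => D.Ok x m ∧ Good m

open Classical in
/-- The action of a mode on a sorted word. -/
noncomputable def act : List Mode → Mode → (List Mode →₀ ℂ)
  | [], x => if key x < D.threshold then Finsupp.single [x] 1 else Finsupp.single [] (D.chi x)
  | y :: m, x =>
    if D.Ok x (y :: m) then Finsupp.single (x :: y :: m) 1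
    -- On a sorted word this branch concerns odd `x` only, as an even letter may be repeated; the
    -- square of an odd mode is half its bracket with itself.
    else if x = y then
      (1 / 2 : ℂ) • (str x x • act m (x + x) + (D.charge * cen x x) • Finsupp.single m 1)
    else
      sgn x y • ((act m x).sum fun m' a => a •
        -- The length test makes the recursion terminate. On sorted input a word that fails it is a
        -- permutation of `x :: m`, in front of which `y` may be put directly.
        (if _h : m'.length < (y :: m).length then act m' y else Finsupp.single (y :: m') 1)) +
      str x y • act m (x + y) + (D.charge * cen x y) • Finsupp.single m 1
termination_by m => m.length
decreasing_by
  all_goals first | (simp; done) | assumption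

/-- The linear operator by which a mode acts. -/
noncomputable def modeOp (x : Mode) : (List Mode →₀ ℂ) →ₗ[ℂ] (List Mode →₀ ℂ) :=
  Finsupp.linearCombination ℂ fun m => D.act m x

@[simp] lemma modeOp_single (x : Mode) (m : List Mode) :
    D.modeOp x (Finsupp.single m 1) = D.act m x := by
  simp [modeOp]

lemma threshold_le : D.threshold ≤ 1 := by
  rcases D.consistent with h | h <;> omega

lemma threshold_nonneg : 0 ≤ D.threshold := by
  rcases D.consistent with h | h <;> omega

lemma weight_le (x : Mode) : D.weight x ≤ 3 := by
  unfold weight; split_ifs <;> omega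

lemma one_le_weight (x : Mode) : 1 ≤ D.weight x := by
  unfold weight; split_ifs <;> omega

lemma weight_of_lt {x : Mode} (h : key x < D.threshold) : 2 ≤ D.weight x := by
  unfold weight; split_ifs <;> omega

lemma key_def (x : Mode) : key x = 2 * x.2 ∨ key x = 2 * x.2 + 1 := by
  unfold key; split_ifs <;> simp

/-- This subadditivity dictates weight 1 for the non-lowering modes: such a mode can turn a lowering
mode of weight 2 into `L_{-1}` of weight 3. Two non-lowering modes have mode numbers at least 0, so
their bracket never yields `L_{-1}`. -/
lemma weight_add_le (x y : Mode) : D.weight (x + y) ≤ D.weight x + D.weight y := by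
  by_cases hx : key x < D.threshold
  · have := D.weight_of_lt hx
    have := D.one_le_weight y
    have := D.weight_le (x + y)
    omega
  by_cases hy : key y < D.threshold
  · have := D.weight_of_lt hy
    have := D.one_le_weight x
    have := D.weight_le (x + y)
    omega
  have h1 : x + y ≠ (0, -1) := by
    intro h
    have h2 := congrArg Prod.snd h
    simp only [Prod.snd_add] at h2
    have := D.threshold_nonneg
    rcases key_def x with h | h <;> rcases key_def y with h' | h' <;> omega
  have := D.one_le_weight x
  have := D.one_le_weight y
  have : D.weight (x + y) ≤ 2 := by
    unfold weight; rw [if_neg h1]; split_ifs <;> omega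
  omega

@[simp] lemma wt_cons (x : Mode) (m : List Mode) : D.wt (x :: m) = D.weight x + D.wt m := by
  simp [wt]

@[simp] lemma wt_nil : D.wt [] = 0 := by simp [wt]

lemma wt_perm {m m' : List Mode} (h : m.Perm m') : D.wt m = D.wt m' :=
  (h.map _).sum_eq

variable {D}

lemma Ok.perm {x : Mode} {m m' : List Mode} (h : D.Ok x m) (hm : m'.Perm m) : D.Ok x m' :=
  ⟨h.1, fun y hy => h.2 y (hm.mem_iff.1 hy)⟩

lemma Ok.cons {x y : Mode} {m : List Mode} (h : D.Ok x m) (hy : key x < key y) :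
    D.Ok x (y :: m) := by
  refine ⟨h.1, fun z hz => ?_⟩
  rcases List.mem_cons.1 hz with rfl | hz
  · exact Or.inl hy
  · exact h.2 z hz

lemma Ok.cons_self {x : Mode} {m : List Mode} (h : D.Ok x m) (hx : x.1 = 0) :
    D.Ok x (x :: m) := by
  refine ⟨h.1, fun z hz => ?_⟩
  rcases List.mem_cons.1 hz with rfl | hz
  · exact Or.inr ⟨rfl, hx⟩
  · exact h.2 z hz

lemma Ok.key_le {x y : Mode} {m : List Mode} (h : D.Ok x m) (hy : y ∈ m) : key x ≤ key y := by
  rcases h.2 y hy with h | h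
  · exact h.le
  · rw [h.1]

lemma Ok.trans {x y : Mode} {m : List Mode} (h : D.Ok y m) (hx : key x < key y) :
    D.Ok x (y :: m) := by
  refine ⟨hx.trans h.1, fun z hz => ?_⟩
  rcases List.mem_cons.1 hz with rfl | hz
  · exact Or.inl hx
  · exact Or.inl (hx.trans_le (h.key_le hz))

lemma lt_or_of_not_ok {x y : Mode} {m : List Mode} (h : D.Ok y m) (hx : ¬ D.Ok x (y :: m)) :
    key y < key x ∨ (x = y ∧ x.1 ≠ 0) := by
  by_contra! hc
  rcases hc.1.lt_or_eq with h1 | h1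
  · exact hx (h.trans h1)
  · obtain rfl := key_injective h1
    exact hx (h.cons_self (hc.2 rfl))

lemma not_ok_of_lt {x y : Mode} {m : List Mode} (hx : key y < key x) :
    ¬ D.Ok x (y :: m) := by
  intro h
  exact absurd (h.key_le (List.mem_cons_self)) (by omega)

lemma not_ok_of_odd {x : Mode} {m : List Mode} (hx : x.1 ≠ 0) : ¬ D.Ok x (x :: m) := by
  intro h
  rcases h.2 x List.mem_cons_self with h | h
  · omega
  · exact hx h.2

lemma Good.key_lt {m : List Mode} (h : D.Good m) {x : Mode} (hx : x ∈ m) :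
    key x < D.threshold := by
  induction m with
  | nil => simp at hx
  | cons y m ih =>
    rcases List.mem_cons.1 hx with rfl | hx
    · exact h.1.1
    · exact ih h.2 hx

/-- The order is strict up to repetition of even letters, so the letters determine the sorted word.
Leading words known only up to permutation can therefore be compared. -/
lemma Good.perm_eq {m m' : List Mode} (h : D.Good m) (h' : D.Good m') (hp : m.Perm m') :
    m = m' := by
  induction m generalizing m' with
  | nil => exact (List.nil_perm.1 hp).symm
  | cons x m ih =>
    cases m' with
    | nil => exact List.perm_nil.1 hp
    | cons y m' =>
      have hxy : x = y := by
        apply key_injective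
        apply le_antisymm
        · rcases List.mem_cons.1 (hp.mem_iff.2 (List.mem_cons_self (a := y) (l := m'))) with e | e
          · rw [e]
          · exact h.1.key_le e
        · rcases List.mem_cons.1 (hp.mem_iff.1 (List.mem_cons_self (a := x) (l := m))) with e | e
          · rw [e]
          · exact h'.1.key_le e
      subst hxy
      rw [ih h.2 h'.2 ((List.perm_cons x).1 hp)]

lemma act_of_ok {x : Mode} {m : List Mode} (h : D.Ok x m) :
    D.act m x = Finsupp.single (x :: m) 1 := by
  cases m with
  | nil => rw [act, if_pos h.1]
  | cons y m => rw [act, if_pos h]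

lemma act_nil_of_le {x : Mode} (h : D.threshold ≤ key x) :
    D.act [] x = Finsupp.single [] (D.chi x) := by
  rw [act, if_neg (by omega)]

variable (D) in
/-- The words that may occur in the action of the mode `x` on the word `m`. -/
def Bound (x : Mode) (m : List Mode) : Set (List Mode) :=
  {m' | D.Good m' ∧ m'.sum = x + m.sum ∧ (m'.Perm (x :: m) ∨ m'.length ≤ m.length) ∧
    D.wt m' ≤ D.weight x + D.wt m}

/-- All four bounds go through one recursion on the length. The third one, that a word is either a
rearrangement of all letters or no longer than `m`, justifies the length test in `act`; the sum
gives the gradings and the weight gives the filtration. -/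
theorem act_mem_supported : ∀ (m : List Mode) (x : Mode), D.Good m →
    D.act m x ∈ Finsupp.supported ℂ ℂ (D.Bound x m)
  | [], x, _ => by
    rw [act]
    split_ifs with h
    · refine Finsupp.single_mem_supported _ _ ⟨⟨⟨h, by simp⟩, trivial⟩, by simp, Or.inl ?_, ?_⟩
      · exact List.Perm.refl _
      · simp
    · by_cases hx : x = 0
      · exact Finsupp.single_mem_supported _ _ ⟨trivial, by simp [hx], Or.inr (by simp), by simp⟩
      · simp [chi, hx]
  | y :: m, x, h => by
    have hm : D.Good m := h.2
    have hsingle : x + y = 0 → Finsupp.single m (1 : ℂ) ∈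
        Finsupp.supported ℂ ℂ (D.Bound x (y :: m)) := fun h0 =>
      Finsupp.single_mem_supported _ _ ⟨hm, by simp [← add_assoc, h0], Or.inr (by simp), by
        simp; omega⟩
    have hcen : (D.charge * cen x y) • Finsupp.single m (1 : ℂ) ∈
        Finsupp.supported ℂ ℂ (D.Bound x (y :: m)) := by
      by_cases h0 : x + y = 0
      · exact Submodule.smul_mem _ _ (hsingle h0)
      · simp [cen_of_add_ne h0]
    have hbr : D.act m (x + y) ∈ Finsupp.supported ℂ ℂ (D.Bound x (y :: m)) := by
      refine Finsupp.supported_mono ?_ (act_mem_supported m (x + y) hm)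
      rintro m' ⟨h1, h2, h3, h4⟩
      refine ⟨h1, by rw [h2, List.sum_cons, add_assoc], Or.inr ?_, ?_⟩
      · rcases h3 with h3 | h3
        · rw [h3.length_eq]; simp
        · simp; omega
      · have := D.weight_add_le x y
        simp; omega
    rw [act]
    split_ifs with h1 h2
    · exact Finsupp.single_mem_supported _ _ ⟨⟨h1, h⟩, by simp, Or.inl (List.Perm.refl _), by simp⟩
    · subst h2
      exact Submodule.smul_mem _ _ (Submodule.add_mem _ (Submodule.smul_mem _ _ hbr) hcen)
    · have hlt : key y < key x := (lt_or_of_not_ok h.1 h1).resolve_right fun h => h2 h.1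
      refine Submodule.add_mem _ (Submodule.add_mem _ (Submodule.smul_mem _ _ ?_)
        (Submodule.smul_mem _ _ hbr)) hcen
      refine Submodule.sum_mem _ fun m' hm' => Submodule.smul_mem _ _ ?_
      obtain ⟨b1, b2, b3, b4⟩ := act_mem_supported m x hm hm'
      split_ifs with hl
      · refine Finsupp.supported_mono ?_ (act_mem_supported m' y b1)
        rintro m'' ⟨c1, c2, c3, c4⟩
        refine ⟨c1, by rw [c2, b2, List.sum_cons]; abel, Or.inr ?_, by simp; omega⟩
        rcases c3 with c3 | c3
        · rw [c3.length_eq]; simpa using hl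
        · omega
      · have hp : m'.Perm (x :: m) := b3.resolve_right fun h => hl (by simp; omega)
        have hok : D.Ok y m' := (h.1.cons hlt).perm hp
        refine Finsupp.single_mem_supported _ _ ⟨⟨hok, b1⟩, ?_, Or.inl ?_, by simp; omega⟩
        · rw [List.sum_cons, b2, List.sum_cons]; abel
        · exact (hp.cons y).trans (List.Perm.swap _ _ _)
termination_by m => m.length
decreasing_by
  all_goals first | (simp; done) | (simpa using hl)

lemma mem_of_mem_supported {S : Set (List Mode)} {p : Submodule ℂ (List Mode →₀ ℂ)}
    {v : List Mode →₀ ℂ} (hv : v ∈ Finsupp.supported ℂ ℂ S)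
    (h : ∀ m ∈ S, Finsupp.single m 1 ∈ p) : v ∈ p := by
  rw [Finsupp.supported_eq_span_single] at hv
  refine Submodule.span_le.2 ?_ hv
  rintro _ ⟨m, hm, rfl⟩
  exact h m hm

variable (D) in
/-- The failure of the commutation relation of two modes. -/
noncomputable def defect (x y : Mode) : (List Mode →₀ ℂ) →ₗ[ℂ] (List Mode →₀ ℂ) :=
  D.modeOp x ∘ₗ D.modeOp y - sgn x y • (D.modeOp y ∘ₗ D.modeOp x) -
    str x y • D.modeOp (x + y) - (D.charge * cen x y) • LinearMap.id

lemma defect_eq_zero_iff {x y : Mode} {v : List Mode →₀ ℂ} : D.defect x y v = 0 ↔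
    D.modeOp x (D.modeOp y v) = sgn x y • D.modeOp y (D.modeOp x v) +
      str x y • D.modeOp (x + y) v + (D.charge * cen x y) • v := by
  simp only [defect, LinearMap.sub_apply, LinearMap.smul_apply, LinearMap.comp_apply,
    LinearMap.id_apply, sub_eq_zero]
  constructor <;> intro h
  · rw [← h]; abel
  · rw [h]; abel

lemma defect_comm {x y : Mode} {v : List Mode →₀ ℂ} (h : D.defect x y v = 0) :
    D.defect y x v = 0 := by
  rw [defect_eq_zero_iff] at h ⊢
  rw [h, sgn_comm x y, str_comm x y, cen_comm x y, add_comm y x]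
  rcases sgn_eq_or x y with e | e <;> rw [e] <;> module

/-- If `y` may be put in front of `m`, then `y` applied to `m` is the word `y :: m`, and the
definition of `act` on that word is the required relation. -/
lemma defect_of_ok {x y : Mode} {m : List Mode} (hm : D.Good m) (hy : D.Ok y m)
    (hxy : key y ≤ key x) : D.defect x y (Finsupp.single m 1) = 0 := by
  rcases hxy.lt_or_eq with hlt | heq
  · rw [defect_eq_zero_iff, modeOp_single, modeOp_single, modeOp_single, act_of_ok hy,
      modeOp_single, act, if_neg (not_ok_of_lt hlt), if_neg (by rintro rfl; omega)]
    congr 3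
    rw [modeOp, Finsupp.linearCombination_apply]
    refine Finsupp.sum_congr fun m' hm' => ?_
    split_ifs with hl
    · rfl
    · obtain ⟨-, -, b3, -⟩ := act_mem_supported m x hm hm'
      have hp : m'.Perm (x :: m) := b3.resolve_right fun h => hl (by simp; omega)
      rw [act_of_ok ((hy.cons hlt).perm hp)]
  · obtain rfl := key_injective heq
    by_cases h0 : y.1 = 0
    · rw [defect_eq_zero_iff, str_self_of_even h0, sgn_of_even h0, cen_self_of_even h0]
      simp
    · rw [defect_eq_zero_iff, sgn_self_of_odd h0, modeOp_single, modeOp_single, act_of_ok hy,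
        modeOp_single, act, if_neg (not_ok_of_odd h0), if_pos rfl]
      module

/-- Non-lowering modes act on the empty word by scalars. The only pairs with a possible contribution
from `L_0` or the centre are `L_0, L_0` and `G_0, G_0`; the latter occurs only at threshold 0, where
it amounts to `Δ = c/24`. -/
lemma defect_nil {x y : Mode} (hx : D.threshold ≤ key x) (hy : D.threshold ≤ key y) :
    D.defect x y (Finsupp.single [] 1) = 0 := by
  have key0 : key 0 = 1 := by simp [key]
  have hs : ∀ (a : ℂ), Finsupp.single ([] : List Mode) a = a • Finsupp.single [] 1 := by simp
  have hx2 : 0 ≤ x.2 := by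
    have := D.threshold_nonneg; rcases key_def x with h | h <;> omega
  have hy2 : 0 ≤ y.2 := by
    have := D.threshold_nonneg; rcases key_def y with h | h <;> omega
  have hxy : D.threshold ≤ key (x + y) := by
    have := D.threshold_nonneg
    have := D.threshold_le
    by_contra! hc
    have h1 : x.2 + y.2 = 0 := by
      have : (x + y).2 = x.2 + y.2 := rfl
      rcases key_def (x + y) with h | h <;> omega
    have h2 : x.2 = 0 := by omega
    have h3 : y.2 = 0 := by omega
    unfold key at hx hy hc
    simp only [Prod.fst_add, Prod.snd_add, h2, h3] at hx hy hc
    rcases parity_cases x.1 with e | e <;> rcases parity_cases y.1 with e' | e' <;>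
      simp [e, e', one_add_one_parity] at hx hy hc <;> omega
  rw [defect_eq_zero_iff, modeOp_single, modeOp_single, modeOp_single, act_nil_of_le hx,
    act_nil_of_le hy, act_nil_of_le hxy, hs (D.chi y), hs (D.chi x), map_smul, map_smul,
    modeOp_single, modeOp_single, act_nil_of_le hx, act_nil_of_le hy, hs (D.chi y),
    hs (D.chi x), hs (D.chi (x + y))]
  have hmain : D.chi y * D.chi x = sgn x y * (D.chi x * D.chi y) + str x y * D.chi (x + y) +
      D.charge * cen x y := by
    by_cases h0 : x + y = 0
    · have h2 : x.2 = 0 := by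
        have := congrArg Prod.snd h0; simp at this; omega
      have h3 : y.2 = 0 := by
        have := congrArg Prod.snd h0; simp at this; omega
      obtain ⟨a, m⟩ := x
      obtain ⟨b, n⟩ := y
      simp only at h2 h3
      subst h2 h3
      rcases parity_cases a with rfl | rfl <;> rcases parity_cases b with rfl | rfl
      · simp [sgn, str, cen, chi]
      · simp at h0
      · simp at h0
      · have ht : D.threshold = 0 := by
          have := D.threshold_nonneg
          simp [key] at hx; omega
        have := (D.consistent.resolve_left (by omega)).2
        simp [sgn, str, cen, chi, one_add_one_parity, this]; ring
    · have : ¬ (x = 0 ∧ y = 0) := by rintro ⟨rfl, rfl⟩; simp at h0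
      have : D.chi y * D.chi x = 0 := by
        by_cases h : x = 0
        · have : y ≠ 0 := fun h' => this ⟨h, h'⟩
          simp [chi, this]
        · simp [chi, h]
      rw [mul_comm (D.chi x), this, cen_of_add_ne h0]
      simp [chi, h0]
  linear_combination (norm := module) hmain • (Finsupp.single ([] : List Mode) (1 : ℂ))

/-- When `y` cannot be put in front of `t :: m`, the word is `t` applied to `m`. Both sides are then
rewritten with `t` moved to the left by the relations already known, and they agree by the Jacobi
identity. -/
theorem defect_eq_zero : ∀ (m : List Mode) (x y : Mode), D.Good m →
    D.defect x y (Finsupp.single m 1) = 0 := by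
  suffices H : ∀ (m : List Mode) (x y : Mode), D.Good m → key y ≤ key x →
      D.defect x y (Finsupp.single m 1) = 0 by
    intro m x y hm
    rcases le_total (key y) (key x) with h | h
    · exact H m x y hm h
    · exact defect_comm (H m y x hm h)
  intro m
  induction hn : m.length using Nat.strong_induction_on generalizing m with
  | _ n ih =>
  subst hn
  intro x y hm hxy
  by_cases hy : D.Ok y m
  · exact defect_of_ok hm hy hxy
  cases m with
  | nil =>
    have : D.threshold ≤ key y := by
      by_contra! hc
      exact hy ⟨hc, by simp⟩
    exact defect_nil (this.trans hxy) this
  | cons t m =>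
    have IH : ∀ (m' : List Mode), m'.length ≤ m.length → D.Good m' → ∀ x y,
        D.defect x y (Finsupp.single m' 1) = 0 := by
      intro m' hl hm' x y
      have hl' : m'.length < (t :: m).length := by simp; omega
      rcases le_total (key y) (key x) with h | h
      · exact ih _ hl' m' rfl x y hm' h
      · exact defect_comm (ih _ hl' m' rfl y x hm' h)
    have IHm := IH m le_rfl hm.2
    have hsingle : Finsupp.single (t :: m) (1 : ℂ) = D.modeOp t (Finsupp.single m 1) := by
      rw [modeOp_single, act_of_ok hm.1]
    have hmem : ∀ z, D.modeOp z (Finsupp.single m 1) ∈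
        Finsupp.supported ℂ ℂ (D.Bound z m) := fun z => by
      rw [modeOp_single]; exact act_mem_supported m z hm.2
    rw [hsingle]
    rcases lt_or_of_not_ok hm.1 hy with hlt | ⟨rfl, hodd⟩
    -- The vector `z m` may contain words as long as `t :: m`, outside the induction hypothesis.
    -- These are permutations of `z :: m`, so `t` may be put in front of them and `defect_of_ok`
    -- applies.
    · have H : ∀ z w, key t < key z → t ≠ w → key t ≤ key w →
          D.defect w t (D.modeOp z (Finsupp.single m 1)) = 0 := by
        intro z w hz hw hw'
        refine mem_of_mem_supported (p := LinearMap.ker (D.defect w t)) (hmem z) ?_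
        rintro m' ⟨h1, -, h3, -⟩
        rw [LinearMap.mem_ker]
        rcases h3 with h3 | h3
        · exact defect_of_ok h1 ((hm.1.cons hz).perm h3) hw'
        · exact IH m' h3 h1 w t
      have e1 := defect_eq_zero_iff.1 (H y x hlt (by rintro rfl; omega) (by omega))
      have e2 := defect_eq_zero_iff.1 (H x y (by omega) (by rintro rfl; omega) (by omega))
      have e3 := defect_eq_zero_iff.1 (IHm x t)
      have e4 := defect_eq_zero_iff.1 (IHm y t)
      have e5 := defect_eq_zero_iff.1 (IHm x y)
      have e6 := defect_eq_zero_iff.1 (IHm x (y + t))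
      have e7 := defect_eq_zero_iff.1 (IHm y (x + t))
      have e8 := defect_eq_zero_iff.1 (IHm (x + y) t)
      have j1 := str_jacobi x y t
      have j2 := cen_jacobi x y t
      rw [defect_eq_zero_iff, e3, e4]
      simp only [map_add, map_smul, e1, e2, e5, e6, e7, e8]
      rw [sgn_add_right, sgn_add_right, sgn_add_left]
      rw [show x + (y + t) = x + y + t by abel, show y + (x + t) = x + y + t by abel]
      rw [sgn_comm x y]
      have k1 := congrArg (sgn y t * ·) (cen_mul_sgn x y t)
      have k2 := cen_mul_sgn x t y
      have k3 := congrArg (sgn x t * ·) (cen_mul_sgn y t x)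
      simp only [sgn_comm y t, sgn_comm x y, sgn_comm x t] at k1 k2 k3
      -- For fixed signs, `j1` cancels the terms in `x + y + t`, `j2` the scalar terms, and `k1`,
      -- `k2`, `k3` those where a central pair leaves a single mode.
      rcases sgn_eq_or x y with a | a <;> rcases sgn_eq_or x t with b | b <;>
        rcases sgn_eq_or y t with d | d <;> simp only [a, b, d] at j1 j2 k1 k2 k3 ⊢ <;>
        linear_combination (norm := module) j1 • D.modeOp (x + y + t) (Finsupp.single m 1) +
          (D.charge • j2) • Finsupp.single m (1 : ℂ) +
          (D.charge • k1) • D.modeOp t (Finsupp.single m 1) -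
          (D.charge • k2) • D.modeOp y (Finsupp.single m 1) -
          (D.charge • k3) • D.modeOp x (Finsupp.single m 1)
    -- Here the odd mode `y` equals the first letter, so `y y` has to be evaluated as half of `[y,
    -- y]`, on `m` as well as on `x m`.
    · have hs := sgn_self_of_odd hodd
      rcases hxy.lt_or_eq with hlt | heq
      · have hyy : D.defect y y (D.modeOp x (Finsupp.single m 1)) = 0 := by
          refine mem_of_mem_supported (p := LinearMap.ker (D.defect y y)) (hmem x) ?_
          rintro m' ⟨h1, -, h3, -⟩
          rw [LinearMap.mem_ker]
          rcases h3 with h3 | h3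
          · exact defect_of_ok h1 ((hm.1.cons hlt).perm h3) le_rfl
          · exact IH m' h3 h1 y y
        have e1 := defect_eq_zero_iff.1 hyy
        have e2 := defect_eq_zero_iff.1 (IHm y y)
        have e3 := defect_eq_zero_iff.1 (IHm x y)
        have e4 := defect_eq_zero_iff.1 (IHm x (y + y))
        have e5 := defect_eq_zero_iff.1 (IHm y (x + y))
        have j1 := str_jacobi x y y
        have j2 := cen_jacobi x y y
        rw [hs] at e1 e2
        have e1' : D.modeOp y (D.modeOp y (D.modeOp x (Finsupp.single m 1))) =
            (1 / 2 : ℂ) • (str y y • D.modeOp (y + y) (D.modeOp x (Finsupp.single m 1)) +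
              (D.charge * cen y y) • D.modeOp x (Finsupp.single m 1)) := by
          linear_combination (norm := module) (1 / 2 : ℂ) • e1
        have e2' : D.modeOp y (D.modeOp y (Finsupp.single m 1)) =
            (1 / 2 : ℂ) • (str y y • D.modeOp (y + y) (Finsupp.single m 1) +
              (D.charge * cen y y) • Finsupp.single m (1 : ℂ)) := by
          linear_combination (norm := module) (1 / 2 : ℂ) • e2
        rw [defect_eq_zero_iff, e2', e3]
        simp only [map_add, map_smul, e1', e4, e5]
        have k1 := cen_mul_sgn x y y
        have k2 := str_comm (x + y) y
        have k3 := cen_comm (x + y) y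
        rw [sgn_add_left, hs] at k2 k3
        rw [hs] at k1
        rw [sgn_add_right, sgn_add_right, hs, sgn_comm x y]
        rw [show x + (y + y) = x + y + y by abel, show y + (x + y) = x + y + y by abel]
        rw [k2] at j1 ⊢
        rw [k3] at j2 ⊢
        rcases sgn_eq_or x y with a | a <;> rw [a] at j1 j2 k1 <;> simp only [a] <;>
        linear_combination (norm := module)
          ((1 / 2 : ℂ) • j1) • D.modeOp (x + y + y) (Finsupp.single m 1) +
          ((D.charge / 2) • j2) • Finsupp.single m (1 : ℂ) -
          (D.charge • k1) • D.modeOp y (Finsupp.single m 1)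
      -- All three modes coincide: the claim reduces to the commutation of `y` with its square.
      · obtain rfl := key_injective heq
        have e2 := defect_eq_zero_iff.1 (IHm y y)
        have e4 := defect_eq_zero_iff.1 (IHm y (y + y))
        rw [hs] at e2
        have e2' : D.modeOp y (D.modeOp y (Finsupp.single m 1)) =
            (1 / 2 : ℂ) • (str y y • D.modeOp (y + y) (Finsupp.single m 1) +
              (D.charge * cen y y) • Finsupp.single m (1 : ℂ)) := by
          linear_combination (norm := module) (1 / 2 : ℂ) • e2
        rw [str_self_add_self_of_odd hodd, cen_self_add_self_of_odd hodd, sgn_add_right, hs] at e4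
        rw [defect_eq_zero_iff, e2']
        simp only [map_add, map_smul, e4, hs]
        module

end HWData
end Ramond

/-! ### The representation of `U(R)` on the Poincaré–Birkhoff–Witt space. -/

namespace Ramond

/-- The element of `U(R)` that belongs to a mode. -/
noncomputable def X (x : Mode) : U := if x.1 = 0 then L x.2 else G x.2

lemma X_even (m : ℤ) : X (0, m) = L m := by simp [X]

lemma X_odd (m : ℤ) : X (1, m) = G m := by simp [X]

lemma L_mul_L (m n : ℤ) : L m * L n - L n * L m = ((m : ℂ) - (n : ℂ)) • L (m + n) +
    (if m + n = 0 then ((m : ℂ) ^ 3 - (m : ℂ)) / 12 else 0) • C := by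
  have h := RingQuot.mkAlgHom_rel ℂ (Rel.LL m n)
  simp only [map_sub, map_mul, map_add, map_smul] at h
  exact h

lemma L_mul_G (m n : ℤ) :
    L m * G n - G n * L m = ((m : ℂ) / 2 - (n : ℂ)) • G (m + n) := by
  have h := RingQuot.mkAlgHom_rel ℂ (Rel.LG m n)
  simp only [map_sub, map_mul, map_smul] at h
  exact h

lemma G_mul_G (m n : ℤ) : G m * G n + G n * G m = (2 : ℂ) • L (m + n) +
    (if m + n = 0 then ((m : ℂ) ^ 2 - 1 / 4) / 3 else 0) • C := by
  have h := RingQuot.mkAlgHom_rel ℂ (Rel.GG m n)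
  simp only [map_mul, map_add, map_smul] at h
  exact h

lemma X_mul_C (x : Mode) : X x * C = C * X x := by
  unfold X
  split_ifs
  · have h := RingQuot.mkAlgHom_rel ℂ (Rel.LC x.2)
    simp only [map_mul] at h
    exact h
  · have h := RingQuot.mkAlgHom_rel ℂ (Rel.GC x.2)
    simp only [map_mul] at h
    exact h

lemma F_mul_C : F * C = C * F := by
  have h := RingQuot.mkAlgHom_rel ℂ Rel.FC
  simp only [map_mul] at h
  exact h

/-- The sign of a parity. -/
noncomputable def psign (a : ZMod 2) : ℂ := if a = 0 then 1 else -1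

lemma psign_add (a b : ZMod 2) : psign (a + b) = psign a * psign b := by
  rcases parity_cases a with rfl | rfl <;> rcases parity_cases b with rfl | rfl <;>
    simp [psign, one_add_one_parity]

lemma F_mul_X (x : Mode) : F * X x = psign x.1 • (X x * F) := by
  unfold X psign
  split_ifs
  · have h := RingQuot.mkAlgHom_rel ℂ (Rel.FL x.2)
    simp only [map_mul] at h
    rw [one_smul]
    exact h
  · have h := RingQuot.mkAlgHom_rel ℂ (Rel.FG x.2)
    simp only [map_mul, map_add, map_zero] at h
    change F * G x.2 + G x.2 * F = 0 at h
    linear_combination (norm := module) h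

lemma X_mul_X (x y : Mode) :
    X x * X y = sgn x y • (X y * X x) + str x y • X (x + y) + cen x y • C := by
  obtain ⟨a, m⟩ := x
  obtain ⟨b, n⟩ := y
  rcases parity_cases a with rfl | rfl <;> rcases parity_cases b with rfl | rfl
  · have h := L_mul_L m n
    simp only [X, sgn, str, cen, Prod.mk_add_mk, add_zero, if_true, Prod.mk_eq_zero, true_and]
    linear_combination (norm := module) h
  · have h := L_mul_G m n
    simp [X, sgn, str, cen, Prod.mk_add_mk, Prod.mk_eq_zero]
    linear_combination (norm := module) h
  · have h := L_mul_G n m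
    simp [X, sgn, str, cen, Prod.mk_add_mk, Prod.mk_eq_zero]
    rw [add_comm n m] at h
    linear_combination (norm := module) -h
  · have h := G_mul_G m n
    simp only [X, sgn, str, cen, Prod.mk_add_mk, Prod.mk_eq_zero, one_add_one_parity, one_ne_zero,
      if_false, if_true, true_and]
    linear_combination (norm := module) h

lemma U_induction {P : U → Prop} (scalar : ∀ a : ℂ, P (algebraMap ℂ U a))
    (mode : ∀ x, P (X x)) (central : P C) (parity : P F) (mul : ∀ u v, P u → P v → P (u * v))
    (add : ∀ u v, P u → P v → P (u + v)) (u : U) : P u := by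
  obtain ⟨a, rfl⟩ := RingQuot.mkAlgHom_surjective ℂ Rel u
  induction a using FreeAlgebra.induction with
  | grade0 r => simpa using scalar r
  | grade1 x =>
    cases x with
    | L m => have h := mode (0, m); rw [X_even] at h; exact h
    | G m => have h := mode (1, m); rw [X_odd] at h; exact h
    | C => exact central
    | F => exact parity
  | mul a b ha hb => rw [map_mul]; exact mul _ _ ha hb
  | add a b ha hb => rw [map_add]; exact add _ _ ha hb

lemma C_mul_comm (u : U) : C * u = u * C := by
  induction u using U_induction with
  | scalar a => exact (Algebra.commutes a _).symm
  | mode x => exact (X_mul_C x).symm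
  | central => rfl
  | parity => exact F_mul_C.symm
  | mul u v hu hv => rw [← mul_assoc, hu, mul_assoc, hv, mul_assoc]
  | add u v hu hv => rw [mul_add, hu, hv, add_mul]

namespace HWData

variable (D : HWData)

/-- The space with the Poincaré–Birkhoff–Witt basis. -/
def space : Submodule ℂ (List Mode →₀ ℂ) := Finsupp.supported ℂ ℂ {m | D.Good m}

lemma modeOp_mem (x : Mode) {v : List Mode →₀ ℂ} (hv : v ∈ D.space) :
    D.modeOp x v ∈ D.space := by
  refine mem_of_mem_supported (p := D.space.comap (D.modeOp x)) hv fun m hm => ?_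
  rw [Submodule.mem_comap, modeOp_single]
  exact Finsupp.supported_mono (fun m' h => h.1) (act_mem_supported m x hm)

/-- The parity operator on words. -/
noncomputable def parityOp : (List Mode →₀ ℂ) →ₗ[ℂ] (List Mode →₀ ℂ) :=
  Finsupp.linearCombination ℂ fun m => Finsupp.single m (psign m.sum.1)

lemma parityOp_apply (v : List Mode →₀ ℂ) (m : List Mode) :
    parityOp v m = psign m.sum.1 * v m := by
  induction v using Finsupp.induction_linear with
  | zero => simp
  | add f g hf hg => rw [map_add, Finsupp.add_apply, hf, hg, Finsupp.add_apply, mul_add]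
  | single m' a =>
    by_cases h : m' = m
    · subst h; simp [parityOp, mul_comm]
    · simp [parityOp, h]

lemma parityOp_mem {v : List Mode →₀ ℂ} (hv : v ∈ D.space) : parityOp v ∈ D.space := by
  refine mem_of_mem_supported (p := D.space.comap parityOp) hv fun m hm => ?_
  rw [Submodule.mem_comap, parityOp, Finsupp.linearCombination_single, one_smul]
  exact Finsupp.single_mem_supported _ _ hm

/-- The module with the Poincaré–Birkhoff–Witt basis. -/
def Fock : Type := D.space

noncomputable instance : AddCommGroup D.Fock := inferInstanceAs (AddCommGroup D.space)

noncomputable instance : Module ℂ D.Fock := inferInstanceAs (Module ℂ D.space)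

/-- The expansion of a vector in the basis. -/
noncomputable def expand : D.Fock →ₗ[ℂ] (List Mode →₀ ℂ) := D.space.subtype

variable {D} in
lemma expand_injective : Function.Injective D.expand := Subtype.val_injective

variable {D} in
lemma expand_mem (v : D.Fock) : D.expand v ∈ D.space := v.2

/-- A mode as an endomorphism of the space. -/
noncomputable def modeEnd (x : Mode) : Module.End ℂ D.Fock :=
  (D.modeOp x ∘ₗ D.expand).codRestrict D.space fun v => D.modeOp_mem x v.2

/-- The parity operator as an endomorphism of the space. -/
noncomputable def parityEnd : Module.End ℂ D.Fock :=
  (parityOp ∘ₗ D.expand).codRestrict D.space fun v => D.parityOp_mem v.2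

@[simp] lemma expand_modeEnd (x : Mode) (v : D.Fock) :
    D.expand (D.modeEnd x v) = D.modeOp x (D.expand v) := rfl

@[simp] lemma expand_parityEnd (v : D.Fock) :
    D.expand (D.parityEnd v) = parityOp (D.expand v) := rfl

lemma modeEnd_mul (x y : Mode) : D.modeEnd x * D.modeEnd y =
    sgn x y • (D.modeEnd y * D.modeEnd x) + str x y • D.modeEnd (x + y) +
      cen x y • (D.charge • (1 : Module.End ℂ D.Fock)) := by
  ext1 v
  apply expand_injective
  have h : D.defect x y (D.expand v) = 0 :=
    mem_of_mem_supported (p := LinearMap.ker (D.defect x y)) (expand_mem v) fun m hm =>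
      defect_eq_zero m x y hm
  rw [defect_eq_zero_iff] at h
  rw [smul_smul, mul_comm (cen x y)]
  simpa using h

lemma parityEnd_mul (x : Mode) :
    D.parityEnd * D.modeEnd x = psign x.1 • (D.modeEnd x * D.parityEnd) := by
  ext1 v
  apply expand_injective
  refine mem_of_mem_supported (p := LinearMap.ker
    (parityOp ∘ₗ D.modeOp x - psign x.1 • (D.modeOp x ∘ₗ parityOp)))
    (expand_mem v) (fun m hm => ?_)
    |> fun h => by simpa [sub_eq_zero] using h
  have h1 : parityOp (D.act m x) = (psign x.1 * psign m.sum.1) • D.act m x := by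
    ext m'
    rw [parityOp_apply, Finsupp.smul_apply, smul_eq_mul]
    by_cases h : D.act m x m' = 0
    · simp [h]
    · have := (act_mem_supported m x hm (Finsupp.mem_support_iff.2 h)).2.1
      rw [this, Prod.fst_add, psign_add]
  have h2 : parityOp (Finsupp.single m (1 : ℂ)) = psign m.sum.1 • Finsupp.single m (1 : ℂ) := by
    simp [parityOp]
  simp only [LinearMap.mem_ker, LinearMap.sub_apply, LinearMap.comp_apply, LinearMap.smul_apply,
    modeOp_single, h1, h2, map_smul, smul_smul, sub_self]

/-- The operators by which the generators act. -/
noncomputable def genEnd : Gen → Module.End ℂ D.Fock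
  | .L m => D.modeEnd (0, m)
  | .G m => D.modeEnd (1, m)
  | .C => D.charge • 1
  | .F => D.parityEnd

lemma lift_genEnd_rel {a b : FreeAlgebra ℂ Gen} (h : Rel a b) :
    FreeAlgebra.lift ℂ D.genEnd a = FreeAlgebra.lift ℂ D.genEnd b := by
  cases h with
  | LL m n =>
    have h := D.modeEnd_mul (0, m) (0, n)
    simp only [sgn, str, cen, Prod.mk_add_mk, add_zero, if_true, Prod.mk_eq_zero, true_and] at h
    simp only [map_add, map_sub, map_mul, map_smul, FreeAlgebra.lift_ι_apply, genEnd]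
    linear_combination (norm := module) h
  | LG m n =>
    have h := D.modeEnd_mul (0, m) (1, n)
    simp [sgn, str, cen, Prod.mk_add_mk, Prod.mk_eq_zero] at h
    simp only [map_sub, map_mul, map_smul, FreeAlgebra.lift_ι_apply, genEnd]
    linear_combination (norm := module) h
  | GG m n =>
    have h := D.modeEnd_mul (1, m) (1, n)
    simp only [sgn, str, cen, Prod.mk_add_mk, Prod.mk_eq_zero, one_add_one_parity, one_ne_zero,
      if_false, true_and] at h
    simp only [map_add, map_mul, map_smul, FreeAlgebra.lift_ι_apply, genEnd]
    linear_combination (norm := module) h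
  | LC m => simp [genEnd]
  | GC m => simp [genEnd]
  | FL m => simpa [genEnd, psign] using D.parityEnd_mul (0, m)
  | FC => simp [genEnd]
  | FG m =>
    have h := D.parityEnd_mul (1, m)
    simp only [psign, one_ne_zero, if_false] at h
    simp only [map_add, map_mul, FreeAlgebra.lift_ι_apply, genEnd, map_zero]
    linear_combination (norm := module) h

/-- The representation of `U(R)` on the space with the Poincaré–Birkhoff–Witt basis. -/
noncomputable def rep : U →ₐ[ℂ] Module.End ℂ D.Fock :=
  RingQuot.liftAlgHom ℂ ⟨FreeAlgebra.lift ℂ D.genEnd, fun _ _ => D.lift_genEnd_rel⟩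

lemma rep_op (x : Gen) : D.rep (op x) = D.genEnd x := by
  simp [rep, op]

noncomputable instance : Module U D.Fock := Module.compHom _ D.rep.toRingHom

lemma smul_def (u : U) (v : D.Fock) : u • v = D.rep u v := rfl

instance : IsScalarTower ℂ U D.Fock where
  smul_assoc a u v := by simp [smul_def]

lemma expand_X_smul (x : Mode) (v : D.Fock) : D.expand (X x • v) =
    D.modeOp x (D.expand v) := by
  obtain ⟨a, m⟩ := x
  rcases parity_cases a with rfl | rfl
  · rw [X_even, smul_def, rep_op]; rfl
  · rw [X_odd, smul_def, rep_op]; rfl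

lemma expand_F_smul (v : D.Fock) : D.expand (F • v) = parityOp (D.expand v) := by
  rw [smul_def, rep_op]; rfl

lemma C_smul (v : D.Fock) : C • v = D.charge • v := by
  rw [smul_def, rep_op]; rfl

/-- The highest weight vector. -/
noncomputable def vac : D.Fock :=
  ⟨Finsupp.single [] 1, Finsupp.single_mem_supported _ _ trivial⟩

end HWData
end Ramond

/-! ### Comparison of the induced modules with the Poincaré–Birkhoff–Witt space. -/

namespace Ramond

variable {M : Type} [AddCommGroup M] [Module ℂ M] [Module U M]

/-- `w` is a cyclic highest weight vector with the data `D`. -/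
structure IsHighestWeight (D : HWData) (w : M) : Prop where
  mode : ∀ x, D.threshold ≤ key x → X x • w = D.chi x • w
  central : C • w = D.charge • w
  parity : F • w = w
  cyclic : ∀ v : M, ∃ u : U, u • w = v

namespace IsHighestWeight

variable {D : HWData} {w : M}

/-- The linear map that sends a word to the product of its modes applied to `w`. -/
noncomputable def eval (w : M) : (List Mode →₀ ℂ) →ₗ[ℂ] M :=
  Finsupp.linearCombination ℂ fun m => (m.map X).prod • w

lemma eval_single (m : List Mode) (a : ℂ) :
    eval w (Finsupp.single m a) = a • (m.map X).prod • w := by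
  simp [eval]

lemma eval_vac : eval w (D.expand D.vac) = w := by
  change eval w (Finsupp.single [] 1) = w
  simp [eval_single]

variable [IsScalarTower ℂ U M]

lemma smul_comm_complex (a : ℂ) (u : U) (v : M) : u • a • v = a • u • v := by
  rw [← algebraMap_smul U a v, ← algebraMap_smul U a (u • v), smul_smul, smul_smul,
    Algebra.commutes]

lemma C_smul (hw : IsHighestWeight D w) (v : M) : C • v = D.charge • v := by
  obtain ⟨u, rfl⟩ := hw.cyclic v
  rw [smul_smul, C_mul_comm, mul_smul, hw.central, smul_comm_complex]

lemma X_smul_X_smul (hw : IsHighestWeight D w) (x y : Mode) (v : M) : X x • X y • v =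
    sgn x y • X y • X x • v + str x y • X (x + y) • v + (D.charge * cen x y) • v := by
  rw [smul_smul, X_mul_X, add_smul, add_smul, smul_assoc, smul_assoc, smul_assoc, mul_smul,
    hw.C_smul, smul_smul (cen x y), mul_comm (cen x y)]

/-- Every branch of `act` becomes, after evaluation at `w`, an identity that the relations of `U(R)`
and the highest weight conditions provide. -/
lemma eval_act (hw : IsHighestWeight D w) : ∀ (m : List Mode) (x : Mode), D.Good m →
    eval w (D.act m x) = X x • eval w (Finsupp.single m 1)
  | [], x, _ => by
    rw [HWData.act]
    split_ifs with h
    · simp [eval_single]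
    · simp [eval_single, hw.mode x (by omega)]
  | y :: m, x, h => by
    by_cases h1 : D.Ok x (y :: m)
    · rw [HWData.act_of_ok h1]
      simp [eval_single, mul_smul]
    have hrel := hw.X_smul_X_smul x y (eval w (Finsupp.single m 1))
    have ih := eval_act hw m x h.2
    have hy : eval w (Finsupp.single (y :: m) 1) = X y • eval w (Finsupp.single m 1) := by
      simp [eval_single, mul_smul]
    rw [HWData.act, if_neg h1, hy]
    split_ifs with h2
    · subst h2
      have hodd : x.1 ≠ 0 := by
        rcases HWData.lt_or_of_not_ok h.1 h1 with h | h
        · omega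
        · exact h.2
      rw [sgn_self_of_odd hodd] at hrel
      rw [map_smul, map_add, map_smul, map_smul, eval_act hw m _ h.2]
      generalize X x • X x • eval w (Finsupp.single m 1) = p at hrel ⊢
      generalize X (x + x) • eval w (Finsupp.single m 1) = q at hrel ⊢
      linear_combination (norm := module) -(1 / 2 : ℂ) • hrel
    · have hlt : key y < key x :=
        (HWData.lt_or_of_not_ok h.1 h1).resolve_right fun h => h2 h.1
      rw [hrel, map_add, map_add, map_smul, map_smul, map_smul, eval_act hw m _ h.2, ← ih]
      congr 3
      conv_rhs => rw [← Finsupp.sum_single (D.act m x)]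
      rw [map_finsuppSum, map_finsuppSum, Finsupp.smul_sum]
      refine Finsupp.sum_congr fun m' hm' => ?_
      obtain ⟨b1, b2, b3, b4⟩ := HWData.act_mem_supported m x h.2 hm'
      rw [← mul_one (D.act m x m'), ← smul_eq_mul, ← Finsupp.smul_single, map_smul, map_smul,
        smul_comm_complex, smul_eq_mul, mul_one]
      congr 1
      split_ifs with hl
      · exact eval_act hw m' y b1
      · simp [eval_single, mul_smul]
termination_by m => m.length
decreasing_by
  all_goals first | (simp; done) | (simpa using hl)

lemma eval_modeOp (hw : IsHighestWeight D w) (x : Mode) {v : List Mode →₀ ℂ}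
    (hv : v ∈ D.space) : eval w (D.modeOp x v) = X x • eval w v := by
  let T : M →ₗ[ℂ] M :=
    { toFun := fun v => X x • v
      map_add' := smul_add _
      map_smul' := fun a v => smul_comm_complex a _ v }
  have h := HWData.mem_of_mem_supported
    (p := LinearMap.ker (eval w ∘ₗ D.modeOp x - T ∘ₗ eval w)) hv fun m hm => by
      rw [LinearMap.mem_ker, LinearMap.sub_apply, sub_eq_zero, LinearMap.comp_apply,
        HWData.modeOp_single]
      exact hw.eval_act m x hm
  exact sub_eq_zero.1 h

lemma F_smul_prod (hw : IsHighestWeight D w) (m : List Mode) :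
    F • (m.map X).prod • w = psign m.sum.1 • (m.map X).prod • w := by
  induction m with
  | nil => simp [hw.parity, psign]
  | cons x m ih =>
    rw [List.map_cons, List.prod_cons, mul_smul, smul_smul, F_mul_X, smul_assoc, mul_smul, ih,
      smul_comm_complex, smul_smul, List.sum_cons, Prod.fst_add, psign_add]

lemma eval_parityOp (hw : IsHighestWeight D w) (v : List Mode →₀ ℂ) :
    eval w (HWData.parityOp v) = F • eval w v := by
  induction v using Finsupp.induction_linear with
  | zero => simp
  | add f g hf hg => rw [map_add, map_add, hf, hg, map_add, smul_add]
  | single m a =>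
    rw [eval_single, smul_comm_complex, hw.F_smul_prod]
    rw [HWData.parityOp, Finsupp.linearCombination_single, map_smul, eval_single]

/-- Evaluation is thus `U(R)`-linear, which makes it a left inverse of any homomorphism that sends
`w` to the empty word. -/
lemma eval_smul (hw : IsHighestWeight D w) (u : U) (v : D.Fock) :
    eval w (D.expand (u • v)) = u • eval w (D.expand v) := by
  induction u using U_induction generalizing v with
  | scalar a => rw [algebraMap_smul, algebraMap_smul, map_smul, map_smul]
  | mode x => rw [HWData.expand_X_smul, hw.eval_modeOp x (HWData.expand_mem v)]
  | central => rw [HWData.C_smul, map_smul, map_smul, hw.C_smul]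
  | parity => rw [HWData.expand_F_smul, hw.eval_parityOp]
  | mul u u' hu hu' => rw [mul_smul, hu, hu', mul_smul]
  | add u u' hu hu' => rw [add_smul, map_add, map_add, hu, hu', add_smul]

/-- A homomorphism to the module with the Poincaré–Birkhoff–Witt basis is injective if it
preserves highest weight vectors. -/
lemma injective_of_map_eq_vac (hw : IsHighestWeight D w) (f : M →ₗ[U] D.Fock)
    (hf : f w = D.vac) : Function.Injective f := by
  refine Function.LeftInverse.injective (g := fun v => eval w (D.expand v)) fun v => ?_
  obtain ⟨u, rfl⟩ := hw.cyclic v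
  change eval w (D.expand (f (u • w))) = u • w
  rw [map_smul, hf, hw.eval_smul, eval_vac]

end IsHighestWeight

namespace HWData

variable (D : HWData)

/-- Sorted monomials act on the empty word by successive prefixing, so they give distinct basis
vectors. This is the linear independence in the Poincaré–Birkhoff–Witt theorem. -/
lemma expand_prod_smul_vac {m : List Mode} (hm : D.Good m) :
    D.expand ((m.map X).prod • D.vac) = Finsupp.single m 1 := by
  induction m with
  | nil => rw [List.map_nil, List.prod_nil, one_smul]; rfl
  | cons x m ih =>
    rw [List.map_cons, List.prod_cons, mul_smul, expand_X_smul, ih hm.2, modeOp_single,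
      act_of_ok hm.1]

lemma X_smul_vac {x : Mode} (hx : D.threshold ≤ key x) : X x • D.vac = D.chi x • D.vac := by
  apply expand_injective
  rw [expand_X_smul, map_smul]
  change D.modeOp x (Finsupp.single [] 1) = D.chi x • Finsupp.single [] 1
  rw [modeOp_single, act_nil_of_le hx]
  simp

lemma F_smul_vac : F • D.vac = D.vac := by
  apply expand_injective
  rw [expand_F_smul]
  change parityOp (Finsupp.single [] 1) = Finsupp.single [] 1
  simp [parityOp, psign]

end HWData

/-- The data of the Verma module. -/
noncomputable def vermaData (c Δ : ℂ) : HWData := ⟨c, Δ, 1, Or.inl rfl⟩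

/-- The data of the `G`-closed Verma module. -/
noncomputable def gVermaData (c : ℂ) : HWData := ⟨c, c / 24, 0, Or.inr ⟨rfl, rfl⟩⟩

lemma exists_smul_mk_one {I : Submodule U U} (v : U ⧸ I) :
    ∃ u : U, u • (Submodule.Quotient.mk 1 : U ⧸ I) = v := by
  obtain ⟨u, rfl⟩ := Submodule.Quotient.mk_surjective _ v
  exact ⟨u, by rw [← Submodule.Quotient.mk_smul, smul_eq_mul, mul_one]⟩

lemma smul_mk_one_of_mem {S : Set U} {u : U} {a : ℂ} (h : u - algebraMap ℂ U a ∈ S) :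
    u • (Submodule.Quotient.mk 1 : U ⧸ Submodule.span U S) =
      a • (Submodule.Quotient.mk 1 : U ⧸ Submodule.span U S) := by
  refine (Submodule.Quotient.eq _).2 ?_
  change u • (1 : U) - a • (1 : U) ∈ _
  rw [smul_eq_mul, mul_one, ← Algebra.algebraMap_eq_smul_one]
  exact Submodule.subset_span h

lemma mode_cases {x : Mode} (h : 0 ≤ key x) :
    0 < x.2 ∨ x = 0 ∨ x = (1, 0) := by
  obtain ⟨a, m⟩ := x
  rcases parity_cases a with rfl | rfl <;> simp [key] at h ⊢ <;> omega

lemma isHighestWeight_verma (c Δ : ℂ) :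
    IsHighestWeight (vermaData c Δ) (Verma.hw c Δ) where
  mode x hx := by
    refine smul_mk_one_of_mem ?_
    have hx' : (1 : ℤ) ≤ key x := hx
    rcases mode_cases (zero_le_one.trans hx') with h | rfl | rfl
    · rw [HWData.chi, if_neg (by rintro rfl; simp at h), map_zero, sub_zero]
      refine Or.inl ⟨x.2, h, ?_⟩
      unfold X; split_ifs <;> simp
    · refine Or.inr (Or.inl ?_)
      simp [HWData.chi, X, vermaData]
    · simp [key] at hx'
  central := smul_mk_one_of_mem (Or.inr (Or.inr (Or.inl rfl)))
  parity := by
    have h : F - algebraMap ℂ U 1 ∈ highestWeightConditions c Δ := by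
      rw [map_one]; exact Or.inr (Or.inr (Or.inr rfl))
    exact (smul_mk_one_of_mem h).trans (one_smul ℂ (Verma.hw c Δ))
  cyclic := exists_smul_mk_one

lemma isHighestWeight_gVerma (c : ℂ) :
    IsHighestWeight (gVermaData c) (GVerma.hw c) where
  mode x hx := by
    refine smul_mk_one_of_mem ?_
    rcases mode_cases hx with h | rfl | rfl
    · rw [HWData.chi, if_neg (by rintro rfl; simp at h), map_zero, sub_zero]
      refine Or.inl (Or.inl ⟨x.2, h, ?_⟩)
      unfold X; split_ifs <;> simp
    · refine Or.inl (Or.inr (Or.inl ?_))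
      simp [HWData.chi, X, gVermaData]
    · refine Or.inr ?_
      simp [HWData.chi, X]
  central := smul_mk_one_of_mem (Or.inl (Or.inr (Or.inr (Or.inl rfl))))
  parity := by
    have h : F - algebraMap ℂ U 1 ∈ highestWeightConditions c (c / 24) ∪ {G 0} := by
      rw [map_one]; exact Or.inl (Or.inr (Or.inr (Or.inr rfl)))
    exact (smul_mk_one_of_mem h).trans (one_smul ℂ (GVerma.hw c))
  cyclic := exists_smul_mk_one

lemma conditions_smul_vac {D : HWData} {u : U}
    (hu : u ∈ highestWeightConditions D.charge D.confWeight) : u • D.vac = 0 := by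
  have ht := D.threshold_le
  rcases hu with ⟨m, hm, rfl | rfl⟩ | rfl | rfl | rfl
  · rw [← X_even, D.X_smul_vac (by simp [key]; omega)]
    simp [HWData.chi, hm.ne']
  · rw [← X_odd, D.X_smul_vac (by simp [key]; omega)]
    simp [HWData.chi]
  · rw [sub_smul, algebraMap_smul, ← X_even, D.X_smul_vac (by simp [key]; omega)]
    simp [HWData.chi]
  · rw [sub_smul, algebraMap_smul, D.C_smul, sub_self]
  · rw [sub_smul, one_smul, D.F_smul_vac, sub_self]

lemma exists_verma_hom (c Δ : ℂ) : ∃ f : Verma c Δ →ₗ[U] (vermaData c Δ).Fock,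
    f (Verma.hw c Δ) = (vermaData c Δ).vac := by
  refine ⟨Submodule.liftQ _ (LinearMap.toSpanSingleton U _ (vermaData c Δ).vac)
    (Submodule.span_le.2 fun u hu => ?_), ?_⟩
  · exact conditions_smul_vac (D := vermaData c Δ) hu
  · exact one_smul U _

lemma exists_gVerma_hom (c : ℂ) : ∃ f : GVerma c →ₗ[U] (gVermaData c).Fock,
    f (GVerma.hw c) = (gVermaData c).vac := by
  refine ⟨Submodule.liftQ _ (LinearMap.toSpanSingleton U _ (gVermaData c).vac)
    (Submodule.span_le.2 fun u hu => ?_), ?_⟩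
  · rcases hu with hu | rfl
    · exact conditions_smul_vac (D := gVermaData c) hu
    · change G 0 • (gVermaData c).vac = 0
      rw [← X_odd, HWData.X_smul_vac _ (by simp [key, gVermaData])]
      simp [HWData.chi]
  · exact one_smul U _

end Ramond

/-! ### Leading terms of the mode action with respect to the weight filtration. -/

namespace Ramond
namespace HWData

variable {D : HWData}

variable (D) in
/-- The filtration of the space by the weight of words. -/
def fil (n : ℕ) : Submodule ℂ (List Mode →₀ ℂ) :=
  Finsupp.supported ℂ ℂ {m | D.Good m ∧ D.wt m ≤ n}

lemma fil_mono {n k : ℕ} (h : n ≤ k) : D.fil n ≤ D.fil k :=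
  Finsupp.supported_mono fun _ hm => ⟨hm.1, hm.2.trans h⟩

lemma single_mem_fil {m : List Mode} {n : ℕ} (hm : D.Good m) (h : D.wt m ≤ n) (a : ℂ) :
    Finsupp.single m a ∈ D.fil n :=
  Finsupp.single_mem_supported _ _ ⟨hm, h⟩

lemma apply_eq_zero_of_mem_fil {v : List Mode →₀ ℂ} {n : ℕ} (hv : v ∈ D.fil n)
    {m : List Mode} (h : n < D.wt m) : v m = 0 := by
  by_contra hc
  have := (hv (Finsupp.mem_support_iff.2 hc)).2
  omega

lemma act_mem_fil {m : List Mode} (hm : D.Good m) (x : Mode) {n : ℕ}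
    (h : D.wt m + D.weight x ≤ n) : D.act m x ∈ D.fil n :=
  Finsupp.supported_mono (s := D.Bound x m) (t := {m | D.Good m ∧ D.wt m ≤ n})
    (fun _ h' => ⟨h'.1, by have := h'.2.2.2; omega⟩) (act_mem_supported m x hm)

lemma modeOp_mem_fil {v : List Mode →₀ ℂ} {k : ℕ} (hv : v ∈ D.fil k) (x : Mode) {n : ℕ}
    (h : k + D.weight x ≤ n) : D.modeOp x v ∈ D.fil n := by
  refine mem_of_mem_supported (p := (D.fil n).comap (D.modeOp x)) hv fun m hm => ?_
  rw [Submodule.mem_comap, modeOp_single]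
  exact act_mem_fil hm.1 x (by have := hm.2; omega)

/-- Unlike the definition of `act`, this form has no case distinction, which suits inductions along
the word. -/
lemma act_cons {y : Mode} {m : List Mode} (h : D.Good (y :: m)) (x : Mode) :
    D.act (y :: m) x = sgn x y • D.modeOp y (D.act m x) + str x y • D.act m (x + y) +
      (D.charge * cen x y) • Finsupp.single m 1 := by
  have h1 := defect_eq_zero_iff.1 (defect_eq_zero m x y h.2)
  simpa only [modeOp_single, act_of_ok h.1] using h1

lemma weight_le_two {x : Mode} (h : x ≠ (0, -1)) : D.weight x ≤ 2 := by
  unfold weight; rw [if_neg h]; split_ifs <;> omega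

lemma weight_lowering : D.weight (0, -1) = 3 := by simp [weight]

lemma modeOp_single_of_ok {x : Mode} {m : List Mode} (h : D.Ok x m) (a : ℂ) :
    D.modeOp x (Finsupp.single m a) = Finsupp.single (x :: m) a := by
  rw [← mul_one a, ← smul_eq_mul, ← Finsupp.smul_single, map_smul, modeOp_single, act_of_ok h,
    Finsupp.smul_single]

/-- The leading term of the action of a lowering mode: insertion into the word. -/
lemma exists_act_sub_mem_fil_of_lt {x : Mode} (hx : key x < D.threshold) {m : List Mode}
    (hm : D.Good m) (h : x.1 = 0 ∨ x ∉ m) :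
    ∃ (r : List Mode) (a : ℂ), D.Good r ∧ r.Perm (x :: m) ∧ a ≠ 0 ∧ (x.1 = 0 → a = 1) ∧
      D.act m x - Finsupp.single r a ∈ D.fil (D.wt m + D.weight x - 1) := by
  induction m with
  | nil =>
    have hok : D.Ok x [] := ⟨hx, by simp⟩
    exact ⟨[x], 1, ⟨hok, trivial⟩, List.Perm.refl _, one_ne_zero, fun _ => rfl, by
      rw [act_of_ok hok, sub_self]; exact Submodule.zero_mem _⟩
  | cons y m ih =>
    by_cases hok : D.Ok x (y :: m)
    · exact ⟨x :: y :: m, 1, ⟨hok, hm⟩, List.Perm.refl _, one_ne_zero, fun _ => rfl, by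
        rw [act_of_ok hok, sub_self]; exact Submodule.zero_mem _⟩
    have hlt : key y < key x := by
      refine (lt_or_of_not_ok hm.1 hok).resolve_right ?_
      rintro ⟨rfl, h0⟩
      rcases h with h | h
      · exact h0 h
      · exact h List.mem_cons_self
    obtain ⟨r, a, hr, hp, ha, ha1, hmem⟩ := ih hm.2
      (h.imp_right fun h h' => h (List.mem_cons_of_mem _ h'))
    have hyr : D.Ok y r := (hm.1.cons hlt).perm hp
    refine ⟨y :: r, sgn x y * a, ⟨hyr, hr⟩, (hp.cons y).trans (List.Perm.swap _ _ _),
      ?_, fun h0 => by rw [sgn_of_even h0, ha1 h0, one_mul], ?_⟩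
    · rcases sgn_eq_or x y with e | e <;> simp [e, ha]
    have hw := D.weight_of_lt hx
    have hw' := D.weight_of_lt hm.1.1
    have hw2 := D.weight_le (x + y)
    rw [act_cons hm x]
    have e : sgn x y • D.modeOp y (D.act m x) - Finsupp.single (y :: r) (sgn x y * a) =
        sgn x y • D.modeOp y (D.act m x - Finsupp.single r a) := by
      rw [map_sub, modeOp_single_of_ok hyr, smul_sub, Finsupp.smul_single, smul_eq_mul]
    rw [add_assoc, add_sub_right_comm, e, wt_cons]
    refine Submodule.add_mem _ (Submodule.smul_mem _ _ (modeOp_mem_fil hmem y (by omega)))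
      (Submodule.add_mem _ (Submodule.smul_mem _ _ (act_mem_fil hm.2 _ (by omega)))
        (Submodule.smul_mem _ _ (single_mem_fil hm.2 (by omega) _)))

/-- Moved next to its own copy, an odd mode squares to half a bracket, so the top weight is lost. -/
lemma act_mem_fil_of_odd_mem {x : Mode} (hx : x.1 ≠ 0) {m : List Mode}
    (hm : D.Good m) (h : x ∈ m) : D.act m x ∈ D.fil (D.wt m + D.weight x - 1) := by
  have hw := D.weight_of_lt (hm.key_lt h)
  induction m with
  | nil => simp at h
  | cons y m ih =>
    have hw' := D.weight_of_lt hm.1.1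
    have hw2 := D.weight_le (x + y)
    have h1 : D.act m (x + y) ∈ D.fil (D.wt (y :: m) + D.weight x - 1) :=
      act_mem_fil hm.2 _ (by rw [wt_cons]; omega)
    have h2 : Finsupp.single m (1 : ℂ) ∈ D.fil (D.wt (y :: m) + D.weight x - 1) :=
      single_mem_fil hm.2 (by rw [wt_cons]; omega) _
    rcases List.mem_cons.1 h with rfl | h
    · rw [act, if_neg (not_ok_of_odd hx), if_pos rfl]
      exact Submodule.smul_mem _ _ (Submodule.add_mem _ (Submodule.smul_mem _ _ h1)
        (Submodule.smul_mem _ _ h2))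
    · rw [act_cons hm]
      refine Submodule.add_mem _ (Submodule.add_mem _ (Submodule.smul_mem _ _
        (modeOp_mem_fil (ih hm.2 h) y ?_)) (Submodule.smul_mem _ _ h1)) (Submodule.smul_mem _ _ h2)
      rw [wt_cons]; omega

/-- A raising mode moves to the right until it kills the empty word. Its bracket with a letter has
weight at most 2, no more than the letter that it replaces, unless the bracket is `L_{-1}`, which
the hypothesis excludes. -/
lemma act_mem_fil_of_pos {x : Mode} (hx : 0 < x.2) {m : List Mode} (hm : D.Good m)
    (h : (0, -1) - x ∉ m) : D.act m x ∈ D.fil (D.wt m) := by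
  induction m with
  | nil =>
    have := D.threshold_le
    rw [act_nil_of_le (by rcases key_def x with h | h <;> omega), chi,
      if_neg (by rintro rfl; simp at hx), Finsupp.single_zero]
    exact Submodule.zero_mem _
  | cons y m ih =>
    have hw' := D.weight_of_lt hm.1.1
    have hw2 : D.weight (x + y) ≤ 2 := weight_le_two fun h' => h (by
      rw [← h', add_sub_cancel_left]; exact List.mem_cons_self)
    rw [act_cons hm, wt_cons]
    exact Submodule.add_mem _ (Submodule.add_mem _ (Submodule.smul_mem _ _
      (modeOp_mem_fil (ih hm.2 fun h' => h (List.mem_cons_of_mem _ h')) y (by omega)))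
      (Submodule.smul_mem _ _ (act_mem_fil hm.2 _ (by omega))))
      (Submodule.smul_mem _ _ (single_mem_fil hm.2 (by omega) _))

/-- The constant is the odd number `2m + 1` for `L_m` and equals 2 for `G_m`. -/
lemma str_lowering_sub (x : Mode) : str x ((0, -1) - x) ≠ 0 := by
  obtain ⟨a, m⟩ := x
  rcases parity_cases a with rfl | rfl
  · simp only [str, Prod.mk_sub_mk, sub_zero, if_true]
    intro h
    have h1 : ((m - (-1 - m) : ℤ) : ℂ) = 0 := by push_cast at h ⊢; exact h
    have := Int.cast_eq_zero.1 h1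
    omega
  · simp [str]

/-- The leading term of the action of a raising mode `x`: one factor `L_{-1} - x` of the word is
replaced by `L_{-1}`. -/
lemma exists_act_sub_mem_fil_of_pos {x : Mode} (hx : 0 < x.2) {m : List Mode} (hm : D.Good m)
    (h : (0, -1) - x ∈ m) :
    ∃ (r : List Mode) (a : ℂ), D.Good r ∧ r.Perm ((0, -1) :: m.erase ((0, -1) - x)) ∧ a ≠ 0 ∧
      (x.1 = 0 → ∃ k : ℕ, a = (k + 1) * str x ((0, -1) - x)) ∧
      D.act m x - Finsupp.single r a ∈ D.fil (D.wt m) := by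
  induction m with
  | nil => simp at h
  | cons t m ih =>
    set y : Mode := (0, -1) - x with hy
    have hs := str_lowering_sub x
    rw [← hy] at hs
    have hxy : x + y = (0, -1) := by rw [hy]; abel
    have hth := D.threshold_nonneg
    have hkl : key (0, -1) = -1 := by simp [key]
    have hyl : key y < -1 := by
      have : y.2 = -1 - x.2 := rfl
      rcases key_def y with h | h <;> omega
    have hwt := D.weight_of_lt hm.1.1
    have hone : Finsupp.single m (1 : ℂ) ∈ D.fil (D.wt (t :: m)) :=
      single_mem_fil hm.2 (by rw [wt_cons]; omega) _
    by_cases hty : t = y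
    · rw [hty] at hm hone hwt ⊢
      obtain ⟨r, a, hr, hp, -, ha1, hmem⟩ := exists_act_sub_mem_fil_of_lt
        (x := (0, -1)) (by omega) hm.2 (Or.inl rfl)
      rw [ha1 rfl, weight_lowering] at hmem
      have hnew : str x y • D.act m (x + y) - Finsupp.single r (str x y) ∈
          D.fil (D.wt (y :: m)) := by
        rw [hxy]
        have : Finsupp.single r (str x y) = str x y • Finsupp.single r (1 : ℂ) := by simp
        rw [this, ← smul_sub]
        refine Submodule.smul_mem _ _ (fil_mono ?_ hmem)
        rw [wt_cons]; omega
      -- Further copies of `y` force `y`, hence `x`, to be even. Each copy then contributes the same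
      -- constant with sign `+1`, so the contributions add up to a positive multiple instead of
      -- cancelling.
      by_cases hym : y ∈ m
      · obtain ⟨r', a', hr', hp', -, ha', hmem'⟩ := ih hm.2 hym
        have heven : x.1 = 0 := by
          have h1 := hm.1.2 y hym
          have h2 : y.1 = 0 := h1.elim (fun h => absurd h (lt_irrefl _)) fun h => h.2
          have h3 : y.1 = 0 - x.1 := rfl
          rw [h3] at h2
          exact (sub_eq_zero.1 h2).symm
        have hok : D.Ok y r' := by
          refine ⟨hm.1.1, fun z hz => ?_⟩
          rcases List.mem_cons.1 (hp'.mem_iff.1 hz) with rfl | hz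
          · left; omega
          · exact hm.1.2 z (List.mem_of_mem_erase hz)
        have hrr : y :: r' = r := by
          refine Good.perm_eq ⟨hok, hr'⟩ hr ((hp'.cons y).trans
            ((List.Perm.swap _ _ _).trans ?_))
          exact ((List.perm_cons_erase hym).symm.cons _).trans hp.symm
        obtain ⟨k, hk⟩ := ha' heven
        refine ⟨r, a' + str x y, hr, by simpa using hp, ?_, fun _ => ⟨k + 1, ?_⟩, ?_⟩
        · rw [hk]
          have : ((k : ℂ) + 1) * str x y + str x y = ((k + 2 : ℕ) : ℂ) * str x y := by
            push_cast; ring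
          rw [this]
          exact mul_ne_zero (Nat.cast_ne_zero.2 (by omega)) hs
        · rw [hk]; push_cast; ring
        · rw [act_cons hm, sgn_of_even heven, one_smul, Finsupp.single_add]
          have e : D.modeOp y (D.act m x) + str x y • D.act m (x + y) +
              (D.charge * cen x y) • Finsupp.single m 1 -
              (Finsupp.single r a' + Finsupp.single r (str x y)) =
              D.modeOp y (D.act m x - Finsupp.single r' a') +
              (str x y • D.act m (x + y) - Finsupp.single r (str x y)) +
              (D.charge * cen x y) • Finsupp.single m 1 := by
            rw [map_sub, modeOp_single_of_ok hok, hrr]; abel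
          rw [e]
          exact Submodule.add_mem _ (Submodule.add_mem _ (modeOp_mem_fil hmem' y
            (by rw [wt_cons]; omega)) hnew) (Submodule.smul_mem _ _ hone)
      · refine ⟨r, str x y, hr, by simpa using hp, hs, fun _ => ⟨0, by simp⟩, ?_⟩
        rw [act_cons hm, add_sub_right_comm, add_sub_assoc]
        exact Submodule.add_mem _ (Submodule.add_mem _ (Submodule.smul_mem _ _
          (modeOp_mem_fil (act_mem_fil_of_pos hx hm.2 hym) y (by rw [wt_cons]; omega))) hnew)
          (Submodule.smul_mem _ _ hone)
    · have hym : y ∈ m := (List.mem_cons.1 h).resolve_left fun h => hty h.symm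
      have hlt : key t < key y := by
        rcases hm.1.2 y hym with h | h
        · exact h
        · exact absurd h.1 hty
      obtain ⟨r, a, hr, hp, ha, ha', hmem⟩ := ih hm.2 hym
      have hok : D.Ok t r := by
        refine ⟨hm.1.1, fun z hz => ?_⟩
        rcases List.mem_cons.1 (hp.mem_iff.1 hz) with rfl | hz
        · left; omega
        · exact hm.1.2 z (List.mem_of_mem_erase hz)
      refine ⟨t :: r, sgn x t * a, ⟨hok, hr⟩, ?_, ?_, fun h0 => ?_, ?_⟩
      · rw [List.erase_cons_tail (by simpa using hty)]
        exact (hp.cons t).trans (List.Perm.swap _ _ _)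
      · rcases sgn_eq_or x t with e | e <;> simp [e, ha]
      · rw [sgn_of_even h0, one_mul]; exact ha' h0
      · have hw2 : D.weight (x + t) ≤ 2 := weight_le_two fun h' => hty (by
          rw [hy, ← h', add_sub_cancel_left])
        have e : sgn x t • D.modeOp t (D.act m x) - Finsupp.single (t :: r) (sgn x t * a) =
            sgn x t • D.modeOp t (D.act m x - Finsupp.single r a) := by
          rw [map_sub, modeOp_single_of_ok hok, smul_sub, Finsupp.smul_single, smul_eq_mul]
        rw [act_cons hm, add_assoc, add_sub_right_comm, e]
        exact Submodule.add_mem _ (Submodule.smul_mem _ _ (modeOp_mem_fil hmem t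
          (by rw [wt_cons]; omega)))
          (Submodule.add_mem _ (Submodule.smul_mem _ _ (act_mem_fil hm.2 _
            (by rw [wt_cons]; omega))) (Submodule.smul_mem _ _ hone))

lemma act_zero {m : List Mode} (hm : D.Good m) :
    D.act m 0 = (D.confWeight - m.sum.2) • Finsupp.single m 1 := by
  induction m with
  | nil =>
    have h0 : key 0 = 1 := by simp [key]
    rw [act_nil_of_le (h0 ▸ D.threshold_le)]
    simp [chi]
  | cons y m ih =>
    have h1 : str 0 y = -y.2 := by
      simp [str]
    have h2 : cen 0 y = 0 := by simp [cen]
    rw [act_cons hm, ih hm.2, zero_add, act_of_ok hm.1, h1, h2, sgn_of_even rfl, map_smul,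
      modeOp_single, act_of_ok hm.1, List.sum_cons, Prod.snd_add]
    push_cast
    module

lemma modeOp_zero_apply {v : List Mode →₀ ℂ} (hv : v ∈ D.space) (m : List Mode) :
    D.modeOp 0 v m = (D.confWeight - m.sum.2) * v m := by
  let T : (List Mode →₀ ℂ) →ₗ[ℂ] ℂ := Finsupp.lapply m ∘ₗ D.modeOp 0 -
    (D.confWeight - m.sum.2 : ℂ) • Finsupp.lapply m
  have : v ∈ LinearMap.ker T := by
    refine mem_of_mem_supported hv fun m' hm' => ?_
    rw [LinearMap.mem_ker, LinearMap.sub_apply, LinearMap.comp_apply, modeOp_single,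
      act_zero hm']
    by_cases h : m' = m
    · subst h; simp
    · simp [h]
  exact sub_eq_zero.1 this

end HWData
end Ramond

/-! ### Leading words of singular vectors and the upper bounds. -/

namespace Ramond
namespace HWData

variable {D : HWData}

variable (D) in
/-- The expansion in words of a singular vector (or of zero) of level `l` and parity `q`. -/
structure SingularWords (l : ℕ) (q : ZMod 2) (v : List Mode →₀ ℂ) : Prop where
  mem : v ∈ D.space
  weight : D.modeOp 0 v = (D.confWeight + l) • v
  parity : parityOp v = psign q • v
  positive : ∀ x : Mode, 0 < x.2 → D.modeOp x v = 0

lemma psign_injective {a b : ZMod 2} (h : psign a = psign b) : a = b := by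
  rcases parity_cases a with rfl | rfl <;> rcases parity_cases b with rfl | rfl <;>
    first | rfl | (norm_num [psign] at h)

lemma SingularWords.sum_eq {l : ℕ} {q : ZMod 2} {v : List Mode →₀ ℂ} (h : D.SingularWords l q v)
    {m : List Mode} (hm : v m ≠ 0) : m.sum = (q, -(l : ℤ)) := by
  have h1 := DFunLike.congr_fun h.weight m
  have h2 := DFunLike.congr_fun h.parity m
  rw [modeOp_zero_apply h.mem, Finsupp.smul_apply, smul_eq_mul] at h1
  rw [parityOp_apply, Finsupp.smul_apply, smul_eq_mul] at h2
  have h3 := mul_right_cancel₀ hm h1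
  refine Prod.ext (psign_injective (mul_right_cancel₀ hm h2)) ?_
  have h4 : ((m.sum.2 : ℤ) : ℂ) = ((-(l : ℤ) : ℤ) : ℂ) := by
    push_cast
    linear_combination -h3
  exact Int.cast_injective h4

/-- A coefficient of the image of `v` to which only one word of `v` contributes. -/
lemma apply_eq_of_unique {v : List Mode →₀ ℂ} (x : Mode) {M r : List Mode}
    (h : ∀ m ∈ v.support, m ≠ M → D.act m x r = 0) :
    D.modeOp x v r = v M * D.act M x r := by
  rw [modeOp, Finsupp.linearCombination_apply, Finsupp.sum_apply, Finsupp.sum,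
    Finset.sum_eq_single M]
  · simp
  · intro m hm hne
    simp [h m hm hne]
  · intro hM
    simp [Finsupp.notMem_support_iff.1 hM]

/-- A letter `y` with mode number below `-1` could be turned into `L_{-1}` by a positive mode,
producing in `x v` a word of weight one more than `M` that nothing cancels. -/
lemma neg_one_le_of_leading {v : List Mode →₀ ℂ} (hv : v ∈ D.space)
    (hpos : ∀ x : Mode, 0 < x.2 → D.modeOp x v = 0) {M : List Mode} (hM : v M ≠ 0)
    (hmax : ∀ m, v m ≠ 0 → D.wt m ≤ D.wt M) {y : Mode} (hy : y ∈ M) : -1 ≤ y.2 := by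
  by_contra! hc
  set x : Mode := (0, -1) - y with hx
  have hx2 : x.2 = -1 - y.2 := rfl
  have hxpos : 0 < x.2 := by omega
  have hyx : (0, -1) - x = y := by rw [hx]; abel
  have hgood : ∀ m, v m ≠ 0 → D.Good m := fun m hm => hv (Finsupp.mem_support_iff.2 hm)
  obtain ⟨r, a, hr, hp, ha, -, hmem⟩ :=
    exists_act_sub_mem_fil_of_pos hxpos (hgood M hM) (hyx.symm ▸ hy)
  rw [hyx] at hp
  have hyw : D.weight y = 2 := by
    have h1 := D.weight_of_lt ((hgood M hM).key_lt hy)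
    have h2 := weight_le_two (D := D) (x := y) (by rintro rfl; simp at hc)
    omega
  have hwr : D.wt r = D.wt M + 1 := by
    have h1 := D.wt_perm hp
    have h2 := D.wt_perm (List.perm_cons_erase hy)
    rw [wt_cons] at h1 h2
    rw [weight_lowering] at h1
    omega
  -- Since `r` has weight `wt M + 1`, another word reaches it only through its own leading term;
  -- removing one `L_{-1}` from `r` and restoring `y` then recovers `M`.
  have key1 := apply_eq_of_unique (D := D) (v := v) x (M := M) (r := r) (by
    intro m hm hne
    have hm' := Finsupp.mem_support_iff.1 hm
    have hle := hmax m hm'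
    by_cases hym : y ∈ m
    · obtain ⟨r', a', hr', hp', -, -, hmem'⟩ :=
        exists_act_sub_mem_fil_of_pos hxpos (hgood m hm') (hyx.symm ▸ hym)
      rw [hyx] at hp'
      have h0 := apply_eq_zero_of_mem_fil hmem' (m := r) (by omega)
      rw [Finsupp.sub_apply, sub_eq_zero] at h0
      rw [h0]
      refine Finsupp.single_eq_of_ne ?_
      rintro rfl
      refine hne (Good.perm_eq (hgood m hm') (hgood M hM) ?_)
      have h1 : (m.erase y).Perm (M.erase y) := (List.perm_cons _).1 (hp'.symm.trans hp)
      exact (List.perm_cons_erase hym).trans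
        ((h1.cons y).trans (List.perm_cons_erase hy).symm)
    · exact apply_eq_zero_of_mem_fil
        (act_mem_fil_of_pos hxpos (hgood m hm') (hyx.symm ▸ hym)) (by omega))
  have h0 := apply_eq_zero_of_mem_fil hmem (m := r) (by omega)
  rw [Finsupp.sub_apply, sub_eq_zero, Finsupp.single_eq_same] at h0
  rw [hpos x hxpos, h0, Finsupp.zero_apply] at key1
  exact mul_ne_zero hM ha key1.symm

/-- Otherwise `G_0` inserts itself into `M` and raises the weight by 2. Words that already contain
`G_0` gain at most 1, and insertion into different words gives different words. -/
lemma G_zero_mem_of_leading {v : List Mode →₀ ℂ} (ht : D.threshold = 1) (hv : v ∈ D.space)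
    (hG : D.modeOp (1, 0) v = 0) {M : List Mode} (hM : v M ≠ 0)
    (hmax : ∀ m, v m ≠ 0 → D.wt m ≤ D.wt M) : (1, 0) ∈ M := by
  by_contra hc
  have hgood : ∀ m, v m ≠ 0 → D.Good m := fun m hm => hv (Finsupp.mem_support_iff.2 hm)
  have hk : key (1, 0) < D.threshold := by rw [ht]; simp [key]
  have hw : D.weight (1, 0) = 2 := by simp [weight, hk]
  obtain ⟨r, a, hr, hp, ha, -, hmem⟩ :=
    exists_act_sub_mem_fil_of_lt hk (hgood M hM) (Or.inr hc)
  have hwr : D.wt r = D.wt M + 2 := by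
    have h1 := D.wt_perm hp
    rw [wt_cons] at h1
    omega
  have key1 := apply_eq_of_unique (D := D) (v := v) (1, 0) (M := M) (r := r) (by
    intro m hm hne
    have hm' := Finsupp.mem_support_iff.1 hm
    have hle := hmax m hm'
    by_cases hym : (1, 0) ∈ m
    · exact apply_eq_zero_of_mem_fil
        (act_mem_fil_of_odd_mem (by simp) (hgood m hm') hym) (by omega)
    · obtain ⟨r', a', hr', hp', -, -, hmem'⟩ :=
        exists_act_sub_mem_fil_of_lt hk (hgood m hm') (Or.inr hym)
      have h0 := apply_eq_zero_of_mem_fil hmem' (m := r) (by omega)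
      rw [Finsupp.sub_apply, sub_eq_zero] at h0
      rw [h0]
      refine Finsupp.single_eq_of_ne ?_
      rintro rfl
      exact hne (Good.perm_eq (hgood m hm') (hgood M hM)
        ((List.perm_cons _).1 (hp'.symm.trans hp))))
  have h0 := apply_eq_zero_of_mem_fil hmem (m := r) (by omega)
  rw [Finsupp.sub_apply, sub_eq_zero, Finsupp.single_eq_same] at h0
  rw [hG, h0, Finsupp.zero_apply] at key1
  exact mul_ne_zero hM ha key1.symm

lemma sum_snd_neg {m : List Mode} (hm : m ≠ []) (h : ∀ y ∈ m, y.2 ≤ -1) : m.sum.2 < 0 := by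
  induction m with
  | nil => exact absurd rfl hm
  | cons x m ih =>
    have hx := h x List.mem_cons_self
    rw [List.sum_cons, Prod.snd_add]
    by_cases h0 : m = []
    · subst h0; simp; omega
    · have := ih h0 fun y hy => h y (List.mem_cons_of_mem _ hy)
      omega

/-- The words in `G_{-1}`, `L_{-1}` and `G_0`. -/
def lowWord (a b d : ℕ) : List Mode :=
  List.replicate a (1, -1) ++ List.replicate b (0, -1) ++ List.replicate d (1, 0)

lemma eq_lowWord {m : List Mode} (hm : D.Good m) (h : ∀ y ∈ m, -1 ≤ y.2) :
    ∃ a b d : ℕ, a ≤ 1 ∧ d ≤ 1 ∧ (D.threshold = 0 → d = 0) ∧ m = lowWord a b d := by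
  induction m with
  | nil => exact ⟨0, 0, 0, by simp, by simp, by simp, rfl⟩
  | cons x m ih =>
    obtain ⟨a, b, d, ha, hd, ht, rfl⟩ := ih hm.2 fun y hy => h y (List.mem_cons_of_mem _ hy)
    have hx := h x List.mem_cons_self
    have hxt := hm.1.1
    have ht1 := D.threshold_le
    have hkl : key (0, -1) = -1 := by simp [key]
    have hkg : key (1, -1) = -2 := by simp [key]
    have hkz : key (1, 0) = 0 := by simp [key]
    have hcases : x = (1, -1) ∨ x = (0, -1) ∨ x = (1, 0) := by
      have : key x = -2 ∨ key x = -1 ∨ key x = 0 := by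
        rcases key_def x with h | h <;> omega
      rcases this with h | h | h
      · exact Or.inl (key_injective (h.trans hkg.symm))
      · exact Or.inr (Or.inl (key_injective (h.trans hkl.symm)))
      · exact Or.inr (Or.inr (key_injective (h.trans hkz.symm)))
    have hok := hm.1.2
    have hazero : x ≠ (1, -1) ∨ a = 0 := by
      by_contra! hc
      have := hok (1, -1) (by simp [lowWord, hc.2])
      rw [hc.1] at this
      simp at this
    rcases hcases with rfl | rfl | rfl
    · have h0 : a = 0 := hazero.resolve_left (by simp)
      subst h0
      exact ⟨1, b, d, le_rfl, hd, ht, rfl⟩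
    · have h0 : a = 0 := by
        by_contra hc
        have := hok (1, -1) (by simp [lowWord, hc])
        rw [hkl, hkg] at this
        simp at this
      subst h0
      exact ⟨0, b + 1, d, by simp, hd, ht, rfl⟩
    · have h0 : lowWord a b d = [] := by
        by_contra hc
        obtain ⟨y, hy⟩ := List.exists_mem_of_ne_nil _ hc
        have h1 := hm.2.key_lt hy
        have h2 := hok y hy
        rw [hkz] at h2
        simp at h2
        omega
      rw [h0]
      exact ⟨0, 0, 1, by simp, le_rfl, fun h => by omega, rfl⟩

lemma lowWord_sum (a b d : ℕ) : (lowWord a b d).sum = ((a + d : ZMod 2), -((a : ℤ) + b)) := by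
  simp [lowWord, List.sum_replicate, Prod.ext_iff]
  ring

lemma G_zero_mem_lowWord {a b d : ℕ} : (1, 0) ∈ lowWord a b d ↔ d ≠ 0 := by
  simp [lowWord]

/-- The possible leading words of a singular vector of level `l` and parity `q`, with (`d = 1`)
and without (`d = 0`) a factor `G_0`. -/
def leadWord (l : ℕ) (q : ZMod 2) (d : ℕ) : List Mode :=
  lowWord (q - d).val (l - (q - d).val) d

/-- For given `d` the parity determines `a ∈ {0, 1}`, and then the level determines `b`. -/
lemma lowWord_eq_leadWord {a b d l : ℕ} {q : ZMod 2} (ha : a ≤ 1)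
    (h : (lowWord a b d).sum = (q, -(l : ℤ))) : lowWord a b d = leadWord l q d := by
  rw [lowWord_sum] at h
  have h1 : (q - d : ZMod 2).val = a := by
    have : q - d = (a : ZMod 2) := by
      have h0 : (a : ZMod 2) + d = q := congrArg Prod.fst h
      rw [← h0, add_sub_cancel_right]
    rw [this, ZMod.val_natCast, Nat.mod_eq_of_lt (by omega)]
  have h2 := congrArg Prod.snd h
  simp only at h2
  -- Here `h2` says `a + b = l`, so the natural subtraction is not truncated.
  rw [leadWord, h1, show l - a = b by omega]

theorem SingularWords.exists_leadWord {l : ℕ} {q : ZMod 2} {v : List Mode →₀ ℂ}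
    (h : D.SingularWords l q v) (hv : v ≠ 0) : ∃ d : ℕ, d ≤ 1 ∧ (D.threshold = 0 → d = 0) ∧
      (D.threshold = 1 → D.modeOp (1, 0) v = 0 → d = 1) ∧ v (leadWord l q d) ≠ 0 := by
  obtain ⟨M, hM, hmax⟩ := Finset.exists_max_image v.support D.wt
    (Finsupp.support_nonempty_iff.2 hv)
  have hM' := Finsupp.mem_support_iff.1 hM
  have hmax' : ∀ m, v m ≠ 0 → D.wt m ≤ D.wt M := fun m hm =>
    hmax m (Finsupp.mem_support_iff.2 hm)
  obtain ⟨a, b, d, ha, hd, ht, rfl⟩ := eq_lowWord (h.mem hM) fun y hy =>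
    neg_one_le_of_leading h.mem h.positive hM' hmax' hy
  refine ⟨d, hd, ht, fun h1 hG => ?_, lowWord_eq_leadWord ha (h.sum_eq hM') ▸ hM'⟩
  have := G_zero_mem_lowWord.1 (G_zero_mem_of_leading h1 h.mem hG hM' hmax')
  omega

end HWData

variable {M : Type} [AddCommGroup M] [Module ℂ M] [Module U M] [IsScalarTower ℂ U M]

/-- If `k` coefficients determine the vectors of `W`, then `W` embeds into `ℂ^k`. -/
lemma rank_le_of_coeff {k : ℕ} {V : Type} [AddCommGroup V] [Module ℂ V] (W : Submodule ℂ V)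
    (f : V →ₗ[ℂ] (List Mode →₀ ℂ)) (K : Fin k → List Mode)
    (h : ∀ v ∈ W, (∀ i, f v (K i) = 0) → v = 0) : Module.rank ℂ W ≤ k := by
  let φ : V →ₗ[ℂ] (Fin k → ℂ) := LinearMap.pi fun i => Finsupp.lapply (K i) ∘ₗ f
  have hinj : Function.Injective (φ ∘ₗ W.subtype) := by
    rw [← LinearMap.ker_eq_bot, LinearMap.ker_eq_bot']
    intro v hv
    exact Subtype.ext (h v v.2 fun i => congrFun hv i)
  simpa using LinearMap.rank_le_of_injective _ hinj

/-- The parity as an element of `ZMod 2`. -/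
def parityOf (p : ℤˣ) : ZMod 2 := if p = 1 then 0 else 1

lemma psign_parityOf (p : ℤˣ) : psign (parityOf p) = ((p : ℤ) : ℂ) := by
  rcases Int.units_eq_one_or p with rfl | rfl
  · simp [parityOf, psign]
  · have : ¬ ((-1 : ℤˣ) = 1) := by decide
    simp [parityOf, psign, this]

/-- The space of the vectors of level `l` and parity `p` that the positive modes annihilate. -/
def highestSpace (M : Type) [AddCommGroup M] [Module ℂ M] [Module U M] [IsScalarTower ℂ U M]
    (Δ : ℂ) (l : ℕ) (p : ℤˣ) : Submodule ℂ M where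
  carrier := {v | L 0 • v = (Δ + (l : ℂ)) • v ∧ F • v = (((p : ℤ) : ℂ)) • v ∧
    ∀ m : ℤ, 0 < m → L m • v = 0 ∧ G m • v = 0}
  add_mem' := by
    rintro a b ⟨h1, h2, h3⟩ ⟨k1, k2, k3⟩
    refine ⟨by simp only [smul_add, h1, k1], by simp only [smul_add, h2, k2], fun m hm => ?_⟩
    simp [smul_add, h3 m hm, k3 m hm]
  zero_mem' := by simp
  smul_mem' := by
    rintro a v ⟨h1, h2, h3⟩
    simp only [Set.mem_ofPred_eq, IsHighestWeight.smul_comm_complex]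
    refine ⟨by rw [h1, smul_comm], by rw [h2, smul_comm], fun m hm => ?_⟩
    simp [h3 m hm]

/-- The vectors that `G_0` annihilates. -/
def gClosedSpace (M : Type) [AddCommGroup M] [Module ℂ M] [Module U M] [IsScalarTower ℂ U M] :
    Submodule ℂ M where
  carrier := {v | G 0 • v = 0}
  add_mem' := by
    rintro a b h k
    simp only [Set.mem_ofPred_eq, smul_add] at *
    rw [h, k, add_zero]
  zero_mem' := by simp
  smul_mem' := by
    rintro a v h
    simp only [Set.mem_ofPred_eq, IsHighestWeight.smul_comm_complex] at *
    rw [h, smul_zero]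

lemma singularWords_of_mem {D : HWData} {l : ℕ} {p : ℤˣ} (f : M →ₗ[U] D.Fock) {v : M}
    (hv : v ∈ highestSpace M D.confWeight l p) :
    D.SingularWords l (parityOf p) (D.expand (f v)) where
  mem := HWData.expand_mem _
  weight := by
    have hf := f.map_smul_of_tower (D.confWeight + (l : ℂ)) v
    rw [← map_smul, ← hf, ← hv.1, ← HWData.expand_X_smul, map_smul f]
    rfl
  parity := by
    have hf := f.map_smul_of_tower ((p : ℤ) : ℂ) v
    rw [← HWData.expand_F_smul, psign_parityOf, ← map_smul D.expand, ← hf, ← hv.2.1, map_smul f]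
  positive x hx := by
    rw [← HWData.expand_X_smul, ← map_smul]
    have : X x • v = 0 := by
      unfold X; split_ifs
      · exact (hv.2.2 x.2 hx).1
      · exact (hv.2.2 x.2 hx).2
    rw [this, map_zero, map_zero]

lemma IsHighestWeight.expand_ne_zero {D : HWData} {w : M} (hw : IsHighestWeight D w)
    {f : M →ₗ[U] D.Fock} (hf : f w = D.vac) {v : M} (hv : v ≠ 0) : D.expand (f v) ≠ 0 :=
  fun h => hv (hw.injective_of_map_eq_vac f hf
    (HWData.expand_injective (by rw [h, map_zero, map_zero])))

theorem rank_le_two {D : HWData} {w : M} (hw : IsHighestWeight D w) (f : M →ₗ[U] D.Fock)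
    (hf : f w = D.vac) {l : ℕ} {p : ℤˣ} {W : Submodule ℂ M}
    (hW : W ≤ highestSpace M D.confWeight l p) : Module.rank ℂ W ≤ 2 := by
  refine rank_le_of_coeff (k := 2) W (D.expand ∘ₗ f.restrictScalars ℂ)
    ![HWData.leadWord l (parityOf p) 0, HWData.leadWord l (parityOf p) 1] fun v hv h => ?_
  by_contra hne
  obtain ⟨d, hd, -, -, hc⟩ :=
    (singularWords_of_mem f (hW hv)).exists_leadWord (hw.expand_ne_zero hf hne)
  interval_cases d
  · exact hc (h 0)
  · exact hc (h 1)

theorem rank_le_one_of_threshold_eq_zero {D : HWData} {w : M} (hw : IsHighestWeight D w)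
    (f : M →ₗ[U] D.Fock) (hf : f w = D.vac) (ht : D.threshold = 0) {l : ℕ} {p : ℤˣ}
    {W : Submodule ℂ M} (hW : W ≤ highestSpace M D.confWeight l p) : Module.rank ℂ W ≤ 1 := by
  refine (rank_le_of_coeff (k := 1) W (D.expand ∘ₗ f.restrictScalars ℂ)
    ![HWData.leadWord l (parityOf p) 0] fun v hv h => ?_).trans_eq Nat.cast_one
  by_contra hne
  obtain ⟨d, -, hd, -, hc⟩ :=
    (singularWords_of_mem f (hW hv)).exists_leadWord (hw.expand_ne_zero hf hne)
  obtain rfl := hd ht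
  exact hc (h 0)

theorem rank_le_one_of_gClosed {D : HWData} {w : M} (hw : IsHighestWeight D w)
    (f : M →ₗ[U] D.Fock) (hf : f w = D.vac) (ht : D.threshold = 1) {l : ℕ} {p : ℤˣ}
    {W : Submodule ℂ M} (hW : W ≤ highestSpace M D.confWeight l p)
    (hG : W ≤ gClosedSpace M) : Module.rank ℂ W ≤ 1 := by
  refine (rank_le_of_coeff (k := 1) W (D.expand ∘ₗ f.restrictScalars ℂ)
    ![HWData.leadWord l (parityOf p) 1] fun v hv h => ?_).trans_eq Nat.cast_one
  by_contra hne
  obtain ⟨d, -, -, hd, hc⟩ :=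
    (singularWords_of_mem f (hW hv)).exists_leadWord (hw.expand_ne_zero hf hne)
  have hGv : G 0 • v = 0 := hG hv
  obtain rfl := hd ht (by
    rw [← HWData.expand_X_smul, X_odd, ← map_smul, hGv, map_zero, map_zero])
  exact hc (h 0)

lemma IsSingular.mem_highestSpace {Δ : ℂ} {w : M} {l : ℕ} {p : ℤˣ} {v : M}
    (h : IsSingular Δ w l p v) : v ∈ highestSpace M Δ l p :=
  ⟨h.weight, h.parity, fun m hm => ⟨h.annihilated_L m hm, h.annihilated_G m hm⟩⟩

/-- A `G`-closed singular vector of a `G`-closed module has level zero. -/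
lemma IsHighestWeight.level_eq_zero {D : HWData} {w : M} (hw : IsHighestWeight D w)
    (ht : D.threshold = 0) {l : ℕ} {v : M} (hv : v ≠ 0)
    (hL : L 0 • v = (D.confWeight + (l : ℂ)) • v) (hG : G 0 • v = 0) : l = 0 := by
  have h := hw.X_smul_X_smul (1, 0) (1, 0) v
  have hc := (D.consistent.resolve_left (by omega)).2
  have e : ((1, 0) : Mode) + (1, 0) = (0, 0) := by simp [one_add_one_parity]
  rw [e, X_odd, X_even, hG, smul_zero, smul_zero, zero_add, hL] at h
  simp only [str, cen, e, one_ne_zero, if_false, Prod.mk_eq_zero, and_self, if_true] at h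
  have h2 : (2 * (l : ℂ)) • v = 0 := by
    rw [hc] at h
    rw [h]
    module
  rcases smul_eq_zero.1 h2 with h3 | h3
  · simpa using h3
  · exact absurd h3 hv

/-- By `level_eq_zero` the level is 0. At threshold 0 every letter has negative mode number, so only
the empty word has level 0 and `v` is a multiple of the highest weight vector. -/
theorem not_isGClosedSingular (c : ℂ) (l : ℕ) (p : ℤˣ) (v : GVerma c) :
    ¬ IsGClosedSingular (c / 24) (GVerma.hw c) l p v := by
  intro h
  have hw := isHighestWeight_gVerma c
  obtain ⟨f, hf⟩ := exists_gVerma_hom c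
  have hne : v ≠ 0 := by
    have := h.not_proportional 0
    rintro rfl
    exact this (zero_smul ℂ (GVerma.hw c)).symm
  obtain rfl := hw.level_eq_zero rfl hne h.weight h.gclosed
  have hs := singularWords_of_mem (D := gVermaData c) f h.toIsSingular.mem_highestSpace
  refine h.not_proportional ((gVermaData c).expand (f v) []) ?_
  apply hw.injective_of_map_eq_vac f hf
  apply HWData.expand_injective
  have h1 := f.map_smul_of_tower ((gVermaData c).expand (f v) []) (GVerma.hw c)
  rw [h1, hf, map_smul]
  change _ = _ • Finsupp.single [] 1
  ext m
  by_cases hm : m = []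
  · subst hm; simp
  · have : (gVermaData c).expand (f v) m = 0 := by
      by_contra hc
      have hgood : (gVermaData c).Good m := hs.mem (Finsupp.mem_support_iff.2 hc)
      have hsum := congrArg Prod.snd (hs.sum_eq hc)
      have hneg : ∀ y ∈ m, y.2 ≤ -1 := fun y hy => by
        have h1 := hgood.key_lt hy
        have h2 : (gVermaData c).threshold = 0 := rfl
        rcases HWData.key_def y with h | h <;> omega
      have := HWData.sum_snd_neg hm hneg
      simp only [Nat.cast_zero, neg_zero] at hsum
      omega
    rw [this]
    simp [Ne.symm hm]

lemma span_le_highestSpace {Δ : ℂ} {w : M} {l : ℕ} {p : ℤˣ} :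
    Submodule.span ℂ {v | IsSingular Δ w l p v} ≤ highestSpace M Δ l p :=
  Submodule.span_le.2 fun _ h => h.mem_highestSpace

theorem rank_singularSpace_le (c Δ : ℂ) (l : ℕ) (p : ℤˣ) :
    Module.rank ℂ (singularSpace c Δ l p) ≤ 2 := by
  obtain ⟨f, hf⟩ := exists_verma_hom c Δ
  exact rank_le_two (isHighestWeight_verma c Δ) f hf (l := l) (p := p) span_le_highestSpace

theorem rank_gVermaSingularSpace_le (c : ℂ) (l : ℕ) (p : ℤˣ) :
    Module.rank ℂ (gVermaSingularSpace c l p) ≤ 1 := by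
  obtain ⟨f, hf⟩ := exists_gVerma_hom c
  exact rank_le_one_of_threshold_eq_zero (isHighestWeight_gVerma c) f hf rfl (l := l) (p := p)
    span_le_highestSpace

theorem rank_gClosedSingularSpace_le (c Δ : ℂ) (l : ℕ) (p : ℤˣ) :
    Module.rank ℂ (gClosedSingularSpace c Δ l p) ≤ 1 := by
  obtain ⟨f, hf⟩ := exists_verma_hom c Δ
  exact rank_le_one_of_gClosed (isHighestWeight_verma c Δ) f hf rfl (l := l) (p := p)
    (Submodule.span_le.2 fun _ h => h.toIsSingular.mem_highestSpace)
    (Submodule.span_le.2 fun _ h => h.gclosed)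

end Ramond

/-! ### Commutation rules and explicit vectors of level 3. -/

namespace Ramond

variable {M : Type} [AddCommGroup M] [Module ℂ M] [Module U M] [IsScalarTower ℂ U M]

/-- The action of an element of `U(R)` as a complex linear map. -/
noncomputable def actMap (u : U) : M →ₗ[ℂ] M where
  toFun v := u • v
  map_add' := smul_add u
  map_smul' a v := IsHighestWeight.smul_comm_complex a u v

lemma actMap_apply (u : U) (v : M) : actMap u v = u • v := rfl

namespace IsHighestWeight

variable {D : HWData} {w : M}

lemma L_L (hw : IsHighestWeight D w) (m n : ℤ) (v : M) : actMap (L m) (actMap (L n) v) =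
    actMap (L n) (actMap (L m) v) + ((m : ℂ) - n) • actMap (L (m + n)) v +
      (D.charge * if m + n = 0 then ((m : ℂ) ^ 3 - m) / 12 else 0) • v := by
  have h := hw.X_smul_X_smul (0, m) (0, n) v
  simp only [Prod.mk_add_mk, add_zero, X_even, sgn, str, cen, if_true, one_smul,
    Prod.mk_eq_zero, true_and] at h
  exact h

lemma L_G (hw : IsHighestWeight D w) (m n : ℤ) (v : M) : actMap (L m) (actMap (G n) v) =
    actMap (G n) (actMap (L m) v) + ((m : ℂ) / 2 - n) • actMap (G (m + n)) v := by
  have h := hw.X_smul_X_smul (0, m) (1, n) v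
  simp only [Prod.mk_add_mk, zero_add, X_even, X_odd, sgn, str, cen, if_true, one_smul,
    Prod.mk_eq_zero, one_ne_zero, false_and, if_false, mul_zero, zero_smul, add_zero] at h
  exact h

lemma G_L (hw : IsHighestWeight D w) (m n : ℤ) (v : M) : actMap (G m) (actMap (L n) v) =
    actMap (L n) (actMap (G m) v) + ((m : ℂ) - (n : ℂ) / 2) • actMap (G (m + n)) v := by
  have h := hw.X_smul_X_smul (1, m) (0, n) v
  simp only [Prod.mk_add_mk, add_zero, X_even, X_odd, sgn, str, cen, if_true, one_smul,
    Prod.mk_eq_zero, one_ne_zero, false_and, if_false, mul_zero, zero_smul, add_zero] at h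
  exact h

lemma G_G (hw : IsHighestWeight D w) (m n : ℤ) (v : M) : actMap (G m) (actMap (G n) v) =
    -actMap (G n) (actMap (G m) v) + (2 : ℂ) • actMap (L (m + n)) v +
      (D.charge * if m + n = 0 then ((m : ℂ) ^ 2 - 1 / 4) / 3 else 0) • v := by
  have h := hw.X_smul_X_smul (1, m) (1, n) v
  simp only [Prod.mk_add_mk, one_add_one_parity, X_even, X_odd, sgn, str, cen,
    Prod.mk_eq_zero, one_ne_zero, true_and, if_false, neg_one_smul] at h
  exact h

lemma L_w (hw : IsHighestWeight D w) {m : ℤ} (hm : 0 < m) : actMap (L m) w = 0 := by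
  have := D.threshold_le
  have h := hw.mode (0, m) (by simp [key]; omega)
  rw [X_even, HWData.chi, if_neg (by simp; omega), zero_smul] at h
  exact h

lemma G_w (hw : IsHighestWeight D w) {m : ℤ} (hm : 0 < m) : actMap (G m) w = 0 := by
  have := D.threshold_le
  have h := hw.mode (1, m) (by simp [key]; omega)
  rw [X_odd, HWData.chi, if_neg (by simp), zero_smul] at h
  exact h

lemma L_zero_w (hw : IsHighestWeight D w) : actMap (L 0) w = D.confWeight • w := by
  have := D.threshold_le
  have h := hw.mode (0, 0) (by simp [key]; omega)
  rw [X_even, HWData.chi, if_pos Prod.mk_zero_zero] at h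
  exact h

/-- `L_1` and `G_1` generate the positive modes: `{G_1, G_n} = 2 L_{n+1}` and `[L_1, G_n] = (1/2 -
n) G_{n+1}` with `1/2 - n ≠ 0`. -/
lemma positive_of_one (hw : IsHighestWeight D w) {v : M} (hL : actMap (L 1) v = 0)
    (hG : actMap (G 1) v = 0) {m : ℤ} (hm : 0 < m) :
    actMap (L m) v = 0 ∧ actMap (G m) v = 0 := by
  induction m, (show (1 : ℤ) ≤ m by omega) using Int.leInduction with
  | base => exact ⟨hL, hG⟩
  | succ n hn ih =>
    have hn' : (1 : ℤ) + n ≠ 0 := by omega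
    obtain ⟨h1, h2⟩ := ih (by omega)
    constructor
    · have h := hw.G_G 1 n v
      rw [h2, hG, map_zero, map_zero, if_neg hn', mul_zero, zero_smul, add_zero, neg_zero,
        zero_add, add_comm] at h
      exact (smul_eq_zero.1 h.symm).resolve_left two_ne_zero
    · have h := hw.L_G 1 n v
      rw [h2, hL, map_zero, map_zero, zero_add, add_comm 1 n] at h
      refine (smul_eq_zero.1 h.symm).resolve_left fun h0 => ?_
      have h1 : ((1 - 2 * n : ℤ) : ℂ) = 0 := by
        push_cast at h0 ⊢; linear_combination 2 * h0
      have := Int.cast_eq_zero.1 h1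
      omega

lemma F_L (m : ℤ) (v : M) :
    actMap F (actMap (L m) v) = actMap (L m) (actMap F v) := by
  have h := F_mul_X (0, m)
  rw [X_even] at h
  simp only [actMap_apply, smul_smul]
  rw [h]
  simp [psign]

lemma F_G (m : ℤ) (v : M) :
    actMap F (actMap (G m) v) = -actMap (G m) (actMap F v) := by
  have h := F_mul_X (1, m)
  rw [X_odd] at h
  simp only [actMap_apply, smul_smul]
  rw [h, smul_assoc]
  simp [psign]

/-- Nonvanishing and linear independence of evaluated words can thus be read off from coefficients.
-/
lemma expand_map_eval {f : M →ₗ[U] D.Fock} (hf : f w = D.vac)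
    {s : List Mode →₀ ℂ} (hs : s ∈ D.space) : D.expand (f (eval w s)) = s := by
  let T : (List Mode →₀ ℂ) →ₗ[ℂ] (List Mode →₀ ℂ) :=
    D.expand ∘ₗ f.restrictScalars ℂ ∘ₗ eval w - LinearMap.id
  have : s ∈ LinearMap.ker T := by
    refine HWData.mem_of_mem_supported hs fun m hm => ?_
    rw [LinearMap.mem_ker, LinearMap.sub_apply, sub_eq_zero]
    change D.expand (f (eval w (Finsupp.single m 1))) = Finsupp.single m 1
    rw [eval_single, one_smul, map_smul, hf, D.expand_prod_smul_vac hm]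
  exact sub_eq_zero.1 this

/-- `G_0` maps singular vectors to singular vectors of the opposite parity. -/
lemma G_zero_smul_mem_highestSpace (hw : IsHighestWeight D w) {Δ : ℂ} {l : ℕ} {p : ℤˣ} {v : M}
    (hv : v ∈ highestSpace M Δ l p) : G 0 • v ∈ highestSpace M Δ l (-p) := by
  obtain ⟨h1, h2, h3⟩ := hv
  have h1' : actMap (L 0) v = (Δ + (l : ℂ)) • v := h1
  have h2' : actMap F v = ((p : ℤ) : ℂ) • v := h2
  have h3' : ∀ m : ℤ, 0 < m → actMap (L m) v = 0 ∧ actMap (G m) v = 0 := h3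
  refine ⟨?_, ?_, fun m hm => ⟨?_, ?_⟩⟩
  · change actMap (L 0) (actMap (G 0) v) = _
    rw [hw.L_G, h1', map_smul]
    simp [actMap_apply]
  · change actMap F (actMap (G 0) v) = _
    rw [F_G, h2', map_smul]
    simp [actMap_apply]
  · change actMap (L m) (actMap (G 0) v) = 0
    rw [hw.L_G, (h3' m hm).1, add_zero, (h3' m hm).2]
    simp
  · change actMap (G m) (actMap (G 0) v) = 0
    rw [hw.G_G, add_zero, (h3' m hm).1, (h3' m hm).2, if_neg hm.ne']
    simp

lemma G_zero_G_zero_smul (hw : IsHighestWeight D w) {l : ℕ} {p : ℤˣ} {v : M}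
    (hv : v ∈ highestSpace M D.confWeight l p) :
    G 0 • G 0 • v = (D.confWeight + l - D.charge / 24) • v := by
  have h1 : actMap (L 0) v = (D.confWeight + (l : ℂ)) • v := hv.1
  have h := hw.G_G 0 0 v
  rw [add_zero, h1, if_pos rfl] at h
  change actMap (G 0) (actMap (G 0) v) = _
  have h2 : (2 : ℂ) • actMap (G 0) (actMap (G 0) v) =
      (2 : ℂ) • (D.confWeight + l - D.charge / 24) • v := by
    push_cast at h
    linear_combination (norm := module) h
  exact smul_right_injective M two_ne_zero h2

end IsHighestWeight

/-- The combinations of words of level `3` and even parity. -/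
noncomputable def levelThree (a : Fin 8 → ℂ) : List Mode →₀ ℂ :=
  Finsupp.single [(0, -1), (0, -1), (0, -1)] (a 0) +
    Finsupp.single [(1, -1), (0, -1), (0, -1), (1, 0)] (a 1) +
    Finsupp.single [(0, -2), (0, -1)] (a 2) + Finsupp.single [(0, -2), (1, -1), (1, 0)] (a 3) +
    Finsupp.single [(1, -2), (0, -1), (1, 0)] (a 4) + Finsupp.single [(1, -2), (1, -1)] (a 5) +
    Finsupp.single [(0, -3)] (a 6) + Finsupp.single [(1, -3), (1, 0)] (a 7)

lemma levelThree_mem (c Δ : ℂ) (a : Fin 8 → ℂ) : levelThree a ∈ (vermaData c Δ).space := by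
  have h : ∀ (m : List Mode) (a : ℂ), (vermaData c Δ).Good m →
      Finsupp.single m a ∈ (vermaData c Δ).space := fun m a hm =>
    Finsupp.single_mem_supported _ _ hm
  refine Submodule.add_mem _ (Submodule.add_mem _ (Submodule.add_mem _ (Submodule.add_mem _
    (Submodule.add_mem _ (Submodule.add_mem _ (Submodule.add_mem _ (h _ _ ?_) (h _ _ ?_))
    (h _ _ ?_)) (h _ _ ?_)) (h _ _ ?_)) (h _ _ ?_)) (h _ _ ?_)) (h _ _ ?_) <;>
    simp [HWData.Good, HWData.Ok, key, vermaData]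

/-- At `c = 0`, `Δ = 1` the equations from `L_1` and `G_1` are linear in the eight coefficients. The
two given solutions have coefficients `(12, 0)` and `(0, 9)` at `L_{-3}` and `G_{-3} G_0`, which
makes their independence visible. -/
lemma levelThree_mem_highestSpace {D : HWData} {w : M} (hw : IsHighestWeight D w)
    (hc : D.charge = 0) (hΔ : D.confWeight = 1) {a : Fin 8 → ℂ}
    (ha : a = ![-8, -8, 36, -15, 42, -39, 12, 0] ∨ a = ![-8, 4, 30, -15, 6, -15, 0, 9]) :
    IsHighestWeight.eval w (levelThree a) ∈ highestSpace M 1 3 1 := by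
  have hF : actMap F w = w := hw.parity
  -- The side conditions orient the commutation rules as rewrite rules that move the larger mode to
  -- the right, towards `w`; `c = 0` removes the central terms.
  have hLL : ∀ (m n : ℤ) (v : M), n < m → actMap (L m) (actMap (L n) v) =
      actMap (L n) (actMap (L m) v) + ((m : ℂ) - n) • actMap (L (m + n)) v := fun m n v _ => by
    rw [hw.L_L, hc]; simp
  have hLG : ∀ (m n : ℤ) (v : M), n ≤ m → actMap (L m) (actMap (G n) v) =
      actMap (G n) (actMap (L m) v) + ((m : ℂ) / 2 - n) • actMap (G (m + n)) v := fun m n v _ =>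
    hw.L_G m n v
  have hGL : ∀ (m n : ℤ) (v : M), n < m → actMap (G m) (actMap (L n) v) =
      actMap (L n) (actMap (G m) v) + ((m : ℂ) - (n : ℂ) / 2) • actMap (G (m + n)) v :=
    fun m n v _ => hw.G_L m n v
  have hGG : ∀ (m n : ℤ) (v : M), n < m → actMap (G m) (actMap (G n) v) =
      -actMap (G n) (actMap (G m) v) + (2 : ℂ) • actMap (L (m + n)) v := fun m n v _ => by
    rw [hw.G_G, hc]; simp
  have hGG' : ∀ (m : ℤ) (v : M), actMap (G m) (actMap (G m) v) = actMap (L (m + m)) v :=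
    fun m v => by
      have h := hw.G_G m m v
      rw [hc, zero_mul, zero_smul, add_zero] at h
      have h2 : (2 : ℂ) • actMap (G m) (actMap (G m) v) = (2 : ℂ) • actMap (L (m + m)) v := by
        linear_combination (norm := module) h
      exact smul_right_injective M two_ne_zero h2
  have hL0 := hw.L_zero_w
  rw [hΔ] at hL0
  have hLw : ∀ m : ℤ, 0 < m → actMap (L m) w = 0 := fun m hm => hw.L_w hm
  have hGw : ∀ m : ℤ, 0 < m → actMap (G m) w = 0 := fun m hm => hw.G_w hm
  have hv : IsHighestWeight.eval w (levelThree a) =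
      a 0 • actMap (L (-1)) (actMap (L (-1)) (actMap (L (-1)) w)) +
      a 1 • actMap (G (-1)) (actMap (L (-1)) (actMap (L (-1)) (actMap (G 0) w))) +
      a 2 • actMap (L (-2)) (actMap (L (-1)) w) +
      a 3 • actMap (L (-2)) (actMap (G (-1)) (actMap (G 0) w)) +
      a 4 • actMap (G (-2)) (actMap (L (-1)) (actMap (G 0) w)) +
      a 5 • actMap (G (-2)) (actMap (G (-1)) w) +
      a 6 • actMap (L (-3)) w + a 7 • actMap (G (-3)) (actMap (G 0) w) := by
    simp only [levelThree, map_add, IsHighestWeight.eval_single, List.map_cons,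
        List.map_nil, List.prod_cons, List.prod_nil, mul_one, mul_smul, X_even, X_odd,
        actMap_apply]
  have key1 : actMap (L 1) (IsHighestWeight.eval w (levelThree a)) = 0 := by
    rw [hv]
    simp (disch := norm_num) only [hLL, hLG, hGL, hGG', hL0, hLw, hGw, map_add, map_smul,
      map_zero, Int.reduceAdd, Int.reduceNeg]
    push_cast
    rcases ha with rfl | rfl <;> simp <;> module
  have key2 : actMap (G 1) (IsHighestWeight.eval w (levelThree a)) = 0 := by
    rw [hv]
    simp (disch := norm_num) only [hLL, hLG, hGL, hGG, hGG', hL0, hLw, hGw, map_add, map_smul,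
      map_zero, map_neg, Int.reduceAdd, Int.reduceNeg]
    push_cast
    rcases ha with rfl | rfl <;> simp <;> module
  refine ⟨?_, ?_, fun m hm => hw.positive_of_one key1 key2 hm⟩
  · change actMap (L 0) (IsHighestWeight.eval w (levelThree a)) = _
    rw [hv]
    simp (disch := norm_num) only [hLL, hLG, hL0, map_add, map_smul, Int.reduceAdd, Int.reduceNeg]
    norm_num
    module
  · change actMap F (IsHighestWeight.eval w (levelThree a)) = _
    rw [hv]
    simp [IsHighestWeight.F_L, IsHighestWeight.F_G, hF]

end Ramond

/-! ### Attainment of the bounds. -/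

namespace Ramond

variable {M : Type} [AddCommGroup M] [Module ℂ M] [Module U M] [IsScalarTower ℂ U M]

namespace IsHighestWeight

variable {D : HWData} {w : M}

lemma self_mem_highestSpace (hw : IsHighestWeight D w) : w ∈ highestSpace M D.confWeight 0 1 := by
  refine ⟨?_, ?_, fun m hm => ⟨hw.L_w hm, hw.G_w hm⟩⟩
  · rw [Nat.cast_zero, add_zero]
    exact hw.L_zero_w
  · rw [hw.parity]
    simp

/-- The highest weight vector has level 0 and parity `+`, so a nonzero vector with another level or
parity is no multiple of it. -/
lemma isSingular_of_mem (hw : IsHighestWeight D w) {l : ℕ} {p : ℤˣ} {v : M}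
    (hv : v ∈ highestSpace M D.confWeight l p) (h0 : v ≠ 0) (hl : l ≠ 0 ∨ p = -1) :
    IsSingular D.confWeight w l p v := by
  refine ⟨hv.1, hv.2.1, fun m hm => (hv.2.2 m hm).1, fun m hm => (hv.2.2 m hm).2, ?_⟩
  rintro a rfl
  rcases hl with hl | rfl
  · have h1 : actMap (L 0) (a • w) = (D.confWeight + (l : ℂ)) • a • w := hv.1
    rw [map_smul, hw.L_zero_w] at h1
    have h2 : (l : ℂ) • a • w = 0 := by linear_combination (norm := module) -h1
    exact (smul_ne_zero (Nat.cast_ne_zero.2 hl) h0) h2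
  · have h1 := hv.2.1
    rw [smul_comm_complex, hw.parity] at h1
    have h2 : (2 : ℂ) • a • w = 0 := by
      push_cast at h1
      linear_combination (norm := module) h1
    exact (smul_ne_zero two_ne_zero h0) h2

lemma eval_ne_zero {f : M →ₗ[U] D.Fock} (hf : f w = D.vac) {s : List Mode →₀ ℂ}
    (hs : s ∈ D.space) (h0 : s ≠ 0) : eval w s ≠ 0 := by
  intro h
  have h1 := expand_map_eval hf hs
  rw [h, map_zero, map_zero] at h1
  exact h0 h1.symm

end IsHighestWeight

lemma one_le_rank_of_mem {V : Type} [AddCommGroup V] [Module ℂ V] {W : Submodule ℂ V} {v : V} (hv : v ∈ W) (h0 : v ≠ 0) :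
    1 ≤ Module.rank ℂ W := by
  refine Cardinal.one_le_iff_ne_zero.2 fun h => ?_
  have := rank_zero_iff.1 h
  exact h0 (congrArg Subtype.val (Subsingleton.elim (⟨v, hv⟩ : W) 0))

lemma two_le_rank_of_mem {V : Type} [AddCommGroup V] [Module ℂ V]
    {W : Submodule ℂ V} {x y : V} (hx : x ∈ W) (hy : y ∈ W)
    (h : ∀ s t : ℂ, s • x + t • y = 0 → s = 0 ∧ t = 0) : 2 ≤ Module.rank ℂ W := by
  have hli : LinearIndependent ℂ ![(⟨x, hx⟩ : W), ⟨y, hy⟩] :=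
    LinearIndependent.pair_iff.2 fun s t hst => h s t (congrArg Subtype.val hst)
  simpa using hli.cardinal_le_rank

lemma ne_zero_of_pair {V : Type} [AddCommGroup V] [Module ℂ V] {x y : V}
    (h : ∀ s t : ℂ, s • x + t • y = 0 → s = 0 ∧ t = 0) :
    x ≠ 0 ∧ y ≠ 0 := by
  constructor <;> rintro rfl
  · exact one_ne_zero (h 1 0 (by simp)).1
  · exact one_ne_zero (h 0 1 (by simp)).2

namespace IsHighestWeight

variable {D : HWData} {w : M}

lemma exists_pair_mem_highestSpace (hw : IsHighestWeight D w) (hD : D = vermaData 0 1)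
    {f : M →ₗ[U] D.Fock} (hf : f w = D.vac) (p : ℤˣ) :
    ∃ x y : M, x ∈ highestSpace M D.confWeight 3 p ∧ y ∈ highestSpace M D.confWeight 3 p ∧
      ∀ s t : ℂ, s • x + t • y = 0 → s = 0 ∧ t = 0 := by
  have hc : D.charge = 0 := by rw [hD]; rfl
  have hΔ : D.confWeight = 1 := by rw [hD]; rfl
  have hmem : ∀ a, levelThree a ∈ D.space := fun a => by
    rw [hD]
    exact levelThree_mem 0 1 a
  have hx := levelThree_mem_highestSpace hw hc hΔ (Or.inl rfl)
  have hy := levelThree_mem_highestSpace hw hc hΔ (Or.inr rfl)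
  rw [← hΔ] at hx hy
  set a : Fin 8 → ℂ := ![-8, -8, 36, -15, 42, -39, 12, 0] with ha
  set b : Fin 8 → ℂ := ![-8, 4, 30, -15, 6, -15, 0, 9] with hb
  set x := eval w (levelThree a) with hxdef
  set y := eval w (levelThree b) with hydef
  have hind : ∀ s t : ℂ, s • x + t • y = 0 → s = 0 ∧ t = 0 := by
    intro s t hst
    have h1 := expand_map_eval hf (s := s • levelThree a + t • levelThree b)
      (Submodule.add_mem _ (Submodule.smul_mem _ _ (hmem a)) (Submodule.smul_mem _ _ (hmem b)))
    rw [map_add, map_smul, map_smul, ← hxdef, ← hydef, hst, map_zero, map_zero] at h1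
    have h2 := DFunLike.congr_fun h1 [(0, -3)]
    have h3 := DFunLike.congr_fun h1 [(1, -3), (1, 0)]
    simp [levelThree, ha, hb] at h2 h3
    exact ⟨h2, h3⟩
  rcases Int.units_eq_one_or p with rfl | rfl
  · exact ⟨x, y, hx, hy, hind⟩
  · refine ⟨G 0 • x, G 0 • y, hw.G_zero_smul_mem_highestSpace hx,
      hw.G_zero_smul_mem_highestSpace hy, fun s t hst => hind s t ?_⟩
    have h := congrArg (actMap (G 0)) hst
    rw [map_add, (actMap (G 0)).map_smul s, (actMap (G 0)).map_smul t, map_zero,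
      actMap_apply, actMap_apply, hw.G_zero_G_zero_smul hx,
      hw.G_zero_G_zero_smul hy, hc, hΔ] at h
    -- `G_0^2` acts by `Δ + l - c/24 = 1 + 3 - 0 = 4`, so `G_0` preserves the independence of the
    -- even pair.
    have h4 : (4 : ℂ) • (s • x + t • y) = 0 := by
      rw [← h]
      push_cast
      module
    exact (smul_eq_zero.1 h4).resolve_left (by norm_num)

/-- The even vector is `L_{-1} w`: `L_1` and `G_1` send it to multiples of `L_0 w` and `G_0 w`,
which vanish for `c = 0`. As `G_0^2` acts by 1 at level 1, applying `G_0` gives the odd vector. -/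
lemma exists_mem_highestSpace_one (hw : IsHighestWeight D w) (hD : D = gVermaData 0)
    {f : M →ₗ[U] D.Fock} (hf : f w = D.vac) (p : ℤˣ) :
    ∃ v : M, v ≠ 0 ∧ v ∈ highestSpace M D.confWeight 1 p := by
  have hc : D.charge = 0 := by rw [hD]; rfl
  have hΔ : D.confWeight = 0 := by rw [hD]; exact zero_div _
  have hG0 : actMap (G 0) w = 0 := by
    have h := hw.mode (1, 0) (by simp [hD, key, gVermaData])
    rw [X_odd, HWData.chi, if_neg (by simp), zero_smul] at h
    exact h
  have hL0 : actMap (L 0) w = 0 := by rw [hw.L_zero_w, hΔ, zero_smul]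
  have hv0 : actMap (L (-1)) w ≠ 0 := by
    have h := eval_ne_zero hf (s := Finsupp.single [(0, -1)] 1)
      (Finsupp.single_mem_supported _ _
        (show D.Good [(0, -1)] by simp [hD, HWData.Good, HWData.Ok, key, gVermaData]))
      (by simp)
    simpa [eval_single, X_even, actMap_apply] using h
  have hv : actMap (L (-1)) w ∈ highestSpace M D.confWeight 1 1 := by
    refine ⟨?_, ?_, fun m hm => hw.positive_of_one ?_ ?_ hm⟩
    · change actMap (L 0) (actMap (L (-1)) w) = _
      rw [hw.L_L, hL0, hc, hΔ]
      simp
    · change actMap F (actMap (L (-1)) w) = _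
      rw [F_L, actMap_apply F, hw.parity]
      simp
    · rw [hw.L_L, hw.L_w one_pos, hc]
      simp [hL0]
    · rw [hw.G_L, hw.G_w one_pos]
      simp [hG0]
  rcases Int.units_eq_one_or p with rfl | rfl
  · exact ⟨_, hv0, hv⟩
  · refine ⟨G 0 • actMap (L (-1)) w, fun h => ?_, hw.G_zero_smul_mem_highestSpace hv⟩
    have h2 := hw.G_zero_G_zero_smul hv
    rw [h, smul_zero, hc, hΔ, Nat.cast_one, zero_div, zero_add, sub_zero, one_smul] at h2
    exact hv0 h2.symm

/-- The vector is `G_0 w`: here `G_0^2 w = (Δ - c/24) w = 0`, and the odd parity separates it from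
`w`. -/
lemma exists_isGClosedSingular_zero (hw : IsHighestWeight D w) (hD : D = vermaData 0 0)
    {f : M →ₗ[U] D.Fock} (hf : f w = D.vac) :
    ∃ v : M, v ≠ 0 ∧ IsGClosedSingular D.confWeight w 0 (-1) v := by
  have h0 : G 0 • w ≠ 0 := by
    have h := eval_ne_zero hf (s := Finsupp.single [(1, 0)] 1)
      (Finsupp.single_mem_supported _ _
        (show D.Good [(1, 0)] by simp [hD, HWData.Good, HWData.Ok, key, vermaData]))
      (by simp)
    simpa [eval_single, X_odd] using h
  refine ⟨_, h0, hw.isSingular_of_mem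
    (hw.G_zero_smul_mem_highestSpace hw.self_mem_highestSpace) h0 (Or.inr rfl), ?_⟩
  rw [hw.G_zero_G_zero_smul hw.self_mem_highestSpace]
  simp [hD, vermaData]

/-- A nonzero `G`-closed vector at level 1 needs `G_0^2 = Δ + 1 - c/24 = 0` there, hence `G_0^2 w =
-w`. For `v = -2 L_{-1} w + G_{-1} G_0 w` this gives `G_0 v = 0` and `L_1 v = (-4Δ - 3/2) w`, which
fixes `Δ = -3/8` and `c = 15`; then `G_1 v = (-3 + 2Δ + c/4) G_0 w` vanishes too. -/
lemma exists_isGClosedSingular_one (hw : IsHighestWeight D w) (hD : D = vermaData 15 (-3 / 8))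
    {f : M →ₗ[U] D.Fock} (hf : f w = D.vac) :
    ∃ v : M, v ≠ 0 ∧ IsGClosedSingular D.confWeight w 1 1 v := by
  have hc : D.charge = 15 := by rw [hD]; rfl
  have hΔ : D.confWeight = -3 / 8 := by rw [hD]; rfl
  have hL0 : actMap (L 0) w = (-3 / 8 : ℂ) • w := by rw [hw.L_zero_w, hΔ]
  have hL1 : actMap (L 1) w = 0 := hw.L_w one_pos
  have hG1 : actMap (G 1) w = 0 := hw.G_w one_pos
  have hF : actMap F w = w := hw.parity
  have hGG : actMap (G 0) (actMap (G 0) w) = (-1 : ℂ) • w := by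
    rw [actMap_apply, actMap_apply, hw.G_zero_G_zero_smul hw.self_mem_highestSpace, hc, hΔ]
    congr 1
    norm_num
  have hL1G : actMap (L 1) (actMap (G 0) w) = 0 := by
    rw [hw.L_G, hL1, add_zero, hG1]
    simp
  have hG1G : actMap (G 1) (actMap (G 0) w) = 0 := by
    rw [hw.G_G, hG1, add_zero, hL1]
    simp
  have hL0G : actMap (L 0) (actMap (G 0) w) = (-3 / 8 : ℂ) • actMap (G 0) w := by
    rw [hw.L_G, hL0]
    simp
  have hv0 : (-2 : ℂ) • actMap (L (-1)) w + actMap (G (-1)) (actMap (G 0) w) ≠ 0 := by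
    have h := eval_ne_zero hf
      (s := Finsupp.single [(0, -1)] (-2) + Finsupp.single [(1, -1), (1, 0)] 1)
      (Submodule.add_mem _ (Finsupp.single_mem_supported _ _
        (show D.Good [(0, -1)] by
          simp [hD, HWData.Good, HWData.Ok, key, vermaData])) (Finsupp.single_mem_supported _ _
        (show D.Good [(1, -1), (1, 0)] by
          simp [hD, HWData.Good, HWData.Ok, key, vermaData])))
      (fun h => by
        have h1 := DFunLike.congr_fun h [(0, -1)]
        simp at h1)
    simpa only [map_add, eval_single, List.map_cons, List.map_nil, actMap_apply,
      List.prod_cons, List.prod_nil, mul_one, mul_smul, X_even, X_odd, one_smul] using h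
  have hv : (-2 : ℂ) • actMap (L (-1)) w + actMap (G (-1)) (actMap (G 0) w) ∈
      highestSpace M D.confWeight 1 1 := by
    refine ⟨?_, ?_, fun m hm => hw.positive_of_one ?_ ?_ hm⟩
    · change actMap (L 0) _ = _
      rw [map_add, map_smul, hw.L_L, hL0, hw.L_G, hL0G, hc, hΔ]
      simp
      module
    · change actMap F _ = _
      simp [F_L, F_G, hF]
    · rw [map_add, map_smul, hw.L_L, hL1, hw.L_G, hL1G, hc]
      simp [hL0, hGG]
      module
    · rw [map_add, map_smul, hw.G_L, hG1, hw.G_G, hG1G, hc]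
      simp [hL0G]
      module
  refine ⟨_, hv0, hw.isSingular_of_mem hv hv0 (Or.inl one_ne_zero), ?_⟩
  change actMap (G 0) _ = 0
  rw [map_add, map_smul, hw.G_L, hw.G_G, hGG]
  simp
  module

end IsHighestWeight

theorem exists_rank_singularSpace_eq (p : ℤˣ) :
    ∃ (c Δ : ℂ) (l : ℕ), Module.rank ℂ (singularSpace c Δ l p) = 2 := by
  have hw := isHighestWeight_verma 0 1
  obtain ⟨f, hf⟩ := exists_verma_hom 0 1
  obtain ⟨x, y, hx, hy, h⟩ := hw.exists_pair_mem_highestSpace rfl hf p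
  obtain ⟨hx0, hy0⟩ := ne_zero_of_pair h
  exact ⟨0, 1, 3, le_antisymm (rank_singularSpace_le _ _ _ _) (two_le_rank_of_mem
    (Submodule.subset_span (hw.isSingular_of_mem hx hx0 (Or.inl three_ne_zero)))
    (Submodule.subset_span (hw.isSingular_of_mem hy hy0 (Or.inl three_ne_zero))) h)⟩

theorem exists_rank_gVermaSingularSpace_eq (p : ℤˣ) :
    ∃ (c : ℂ) (l : ℕ), Module.rank ℂ (gVermaSingularSpace c l p) = 1 := by
  have hw := isHighestWeight_gVerma 0
  obtain ⟨f, hf⟩ := exists_gVerma_hom 0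
  obtain ⟨v, hv0, hv⟩ := hw.exists_mem_highestSpace_one rfl hf p
  exact ⟨0, 1, le_antisymm (rank_gVermaSingularSpace_le _ _ _) (one_le_rank_of_mem
    (Submodule.subset_span (hw.isSingular_of_mem hv hv0 (Or.inl one_ne_zero))) hv0)⟩

theorem exists_rank_gClosedSingularSpace_eq (p : ℤˣ) :
    ∃ (c Δ : ℂ) (l : ℕ), Module.rank ℂ (gClosedSingularSpace c Δ l p) = 1 := by
  rcases Int.units_eq_one_or p with rfl | rfl
  · obtain ⟨f, hf⟩ := exists_verma_hom 15 (-3 / 8)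
    obtain ⟨v, hv0, hv⟩ := (isHighestWeight_verma 15 (-3 / 8)).exists_isGClosedSingular_one rfl hf
    exact ⟨15, -3 / 8, 1, le_antisymm (rank_gClosedSingularSpace_le _ _ _ _)
      (one_le_rank_of_mem (Submodule.subset_span hv) hv0)⟩
  · obtain ⟨f, hf⟩ := exists_verma_hom 0 0
    obtain ⟨v, hv0, hv⟩ := (isHighestWeight_verma 0 0).exists_isGClosedSingular_zero rfl hf
    exact ⟨0, 0, 0, le_antisymm (rank_gClosedSingularSpace_le _ _ _ _)
      (one_le_rank_of_mem (Submodule.subset_span hv) hv0)⟩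

end Ramond

theorem mainTheorem2 (p : ℤˣ) :
    ((∀ (c Δ : ℂ) (l : ℕ), Module.rank ℂ (Ramond.singularSpace c Δ l p) ≤ 2) ∧
      (∃ (c Δ : ℂ) (l : ℕ), Module.rank ℂ (Ramond.singularSpace c Δ l p) = 2)) ∧
    ((∀ (c : ℂ) (l : ℕ), Module.rank ℂ (Ramond.gVermaSingularSpace c l p) ≤ 1) ∧
      (∃ (c : ℂ) (l : ℕ), Module.rank ℂ (Ramond.gVermaSingularSpace c l p) = 1)) ∧
    ((∀ (c Δ : ℂ) (l : ℕ), Module.rank ℂ (Ramond.gClosedSingularSpace c Δ l p) ≤ 1) ∧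
      (∃ (c Δ : ℂ) (l : ℕ), Module.rank ℂ (Ramond.gClosedSingularSpace c Δ l p) = 1)) ∧
    (∀ (c : ℂ) (l : ℕ) (v : Ramond.GVerma c),
      ¬ Ramond.IsGClosedSingular (c / 24) (Ramond.GVerma.hw c) l p v) :=
  ⟨⟨fun c Δ l => Ramond.rank_singularSpace_le c Δ l p, Ramond.exists_rank_singularSpace_eq p⟩,
    ⟨fun c l => Ramond.rank_gVermaSingularSpace_le c l p,
      Ramond.exists_rank_gVermaSingularSpace_eq p⟩,
    ⟨fun c Δ l => Ramond.rank_gClosedSingularSpace_le c Δ l p,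
      Ramond.exists_rank_gClosedSingularSpace_eq p⟩,
    fun c l => Ramond.not_isGClosedSingular c l p⟩
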